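/- Let $F$ be the free group on a finite set $\mathcal A$ with $|\mathcal A|=m\ge 2$, and let $\partial F$ be its boundary, i.e. the space of infinite freely reduced words in $\mathcal A\sqcup\mathcal A^{-1}$, on which $F$ acts by concatenation followed by free reduction. Let $\mathbf m$ be the uniform probability measure on $\partial F$, determined by $\mathbf m(C_g)=\frac{1}{2m(2m-1)^{|g|-1}}$ for all $g\in F\setminus\{e\}$, where $C_g$ is the set of infinite words which begin with the reduced word of $g$. Let $H\le F$ be a subgroup and let $X=H\backslash F$ be its Schreier graph: its vertices are the cosets $Hg$, its root is $o=H$, and for every vertex $x$ and every letter $a\in\mathcal A\sqcup\mathcal A^{-1}$ there is an oriented edge labelled $a$ from $x$ to $xa$, its reverse being the edge labelled $a^{-1}$ from $xa$ to $x$. Let $T$ be a spanning tree of $X$ which is geodesic, i.e. $d_T(o,x)=d_X(o,x)$ for every vertex $x$. For an oriented edge $\mathcal E=[x,y]$ of $X$ which is not in $T$, let $s_{\mathcal E}\in H$ be the element obtained by reading the labels along the path $[o,x]_T\,[x,y]\,[y,o]_T$, and let $\overline{\mathcal S}$ be the set of all these elements $s_{\mathcal E}$ (the associated minimal Schreier free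 generators of $H$ and their inverses). Let * $\Omega\subset\partial F$ (the Schreier limit set) be the set of all limits $\lim_{n\to\infty}s_1s_2\cdots s_n$, where $s_1s_2\dots$ is an infinite freely reduced word in the alphabet $\overline{\mathcal S}$ (that is, $s_{n+1}\ne s_n^{-1}$ for all $n$); * $\Delta\subset\partial F$ (the Schreier fundamental domain) be the set of all infinite words which do not begin with the word read along $[o,x]_T\,[x,y]$ for any oriented edge $[x,y]$ of $X$ not in $T$. Then $$\partial F=\Bigl(\bigsqcup_{h\in H}h\Delta\Bigr)\sqcup\Omega$$ is a disjoint decomposition, and it is the Hopf decomposition of the action of $H$ on $(\partial F,\mathbf m)$. That is, $\Omega$ and $\bigcup_{h\in H}h\Delta$ are measurable and $H$-invariant; the action of $H$ on $\Omega$ is conservative, i.e. for every measurable $B\subset\Omega$ of positive measure, almost every $x\in B$ satisfies $hx\in B$ for some $h\in H\setminus\{e\}$; the action on $\bigcup_{h\in H}h\Delta$ is completely dissipative, i.e. this set is the union of the $H$-translates of a measurable set whose translates are pairwise disjoint. Moreover, for every Hopf decomposition $\partial F=\mathcal C\sqcup\mathcal D$ (mod 0) of this action into a conservative part $\mathcal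 C$ and a dissipative part $\mathcal D$ one has $\mathcal C=\Omega$ and $\mathcal D=\bigcup_{h\in H}h\Delta$ (mod 0). In particular, $\Omega$ coincides (mod 0) with the conservative part of the action. -/

import Mathlib

open scoped ENNReal Pointwise
open MeasureTheory Filter

namespace FreeBoundary

/-! ### Letters, infinite reduced words, the boundary action -/

/-- The symmetric alphabet of the free group on `A`: `(a, true)` stands for the generator `a` and
`(a, false)` for its inverse, as in `FreeGroup`. -/
abbrev Letter (A : Type*) := A × Bool

/-- The formal inverse of a letter. -/
def letterInv {A : Type*} (a : Letter A) : Letter A := (a.1, !a.2)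

theorem letterInv_letterInv {A : Type*} (a : Letter A) : letterInv (letterInv a) = a := by
  simp [letterInv]

/-- The element of the free group represented by a letter. -/
def letterElt {A : Type*} (a : Letter A) : FreeGroup A := FreeGroup.mk [a]

/-- The boundary `∂F` of the free group on `A`: infinite freely reduced words. -/
@[ext]
structure Boundary (A : Type*) where
  /-- The sequence of letters. -/
  letter : ℕ → Letter A
  /-- No letter is followed by its inverse. -/
  reduced : ∀ n, letter (n + 1) ≠ letterInv (letter n)

namespace Boundary

variable {A : Type*}

/-- The initial segment of length `n` of an infinite word. -/
def trunc (ω : Boundary A) (n : ℕ) : List (Letter A) := (List.range n).map ω.letter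

/-- The infinite word `ω` begins with the finite word `w`. -/
def BeginsWith (ω : Boundary A) (w : List (Letter A)) : Prop := ω.trunc w.length = w

theorem beginsWith_iff (ω : Boundary A) (w : List (Letter A)) :
    ω.BeginsWith w ↔ ∀ (i : ℕ) (hi : i < w.length), ω.letter i = w[i] := by
  unfold BeginsWith trunc
  constructor
  · intro h i hi
    have h2 := List.getElem_of_eq h (i := i) (by simpa using hi)
    simpa using h2
  · intro h
    apply List.ext_getElem
    · simp
    · intro i h1 h2
      simpa using h i h2

/-- Removing the first letter. -/
def tail (ω : Boundary A) : Boundary A where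
  letter n := ω.letter (n + 1)
  reduced n := ω.reduced (n + 1)

/-- Prepending a letter which does not cancel. -/
def cons (a : Letter A) (ω : Boundary A) (h : ω.letter 0 ≠ letterInv a) : Boundary A where
  letter n := Nat.casesOn n a ω.letter
  reduced n := by
    cases n with
    | zero => exact h
    | succ n => exact ω.reduced n

/-- Concatenation of a letter with an infinite word, followed by free reduction. -/
def mulLetter [DecidableEq A] (a : Letter A) (ω : Boundary A) : Boundary A :=
  if h : ω.letter 0 = letterInv a then ω.tail else cons a ω h

theorem mulLetter_inv_mulLetter [DecidableEq A] (a : Letter A) (ω : Boundary A) :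
    mulLetter (letterInv a) (mulLetter a ω) = ω := by
  by_cases h : ω.letter 0 = letterInv a
  · have h1 : ω.tail.letter 0 ≠ letterInv (letterInv a) := by
      rw [← h]; exact ω.reduced 0
    ext1
    funext n
    simp only [mulLetter, h, dif_pos, h1, dif_neg, not_false_eq_true]
    cases n with
    | zero => exact h.symm
    | succ n => rfl
  · have h1 : (cons a ω h).letter 0 = letterInv (letterInv a) := (letterInv_letterInv a).symm
    simp only [mulLetter, h, dif_neg, not_false_eq_true, h1, dif_pos]
    rfl

/-- The permutation of the boundary induced by a free generator. -/
def genPerm [DecidableEq A] (a : A) : Equiv.Perm (Boundary A) where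
  toFun := mulLetter (a, true)
  invFun := mulLetter (a, false)
  left_inv := mulLetter_inv_mulLetter (a, true)
  right_inv := mulLetter_inv_mulLetter (a, false)

/-- The boundary action of the free group: concatenation followed by free reduction. -/
instance instMulAction [DecidableEq A] : MulAction (FreeGroup A) (Boundary A) :=
  MulAction.compHom (Boundary A) (FreeGroup.lift (genPerm (A := A)))

theorem letterElt_smul [DecidableEq A] (a : Letter A) (ω : Boundary A) :
    letterElt a • ω = mulLetter a ω := by
  obtain ⟨a, b⟩ := a
  change FreeGroup.lift (genPerm (A := A)) (FreeGroup.mk [(a, b)]) ω = _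
  cases b
  · simp only [FreeGroup.lift_mk, List.map_cons, List.map_nil, List.prod_cons, List.prod_nil,
      mul_one, cond_false]
    rfl
  · simp only [FreeGroup.lift_mk, List.map_cons, List.map_nil, List.prod_cons, List.prod_nil,
      mul_one, cond_true]
    rfl

/-- The cylinder `C_g`: the infinite words which begin with the reduced word of `g`. -/
def cylinder [DecidableEq A] (g : FreeGroup A) : Set (Boundary A) :=
  {ω | ω.BeginsWith g.toWord}

theorem cylinder_one [DecidableEq A] : cylinder (1 : FreeGroup A) = Set.univ := by
  ext ω
  simp [cylinder, BeginsWith, trunc]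

/-- The Borel `σ`-algebra of the topology of pointwise convergence (there are countably many
cylinders, and they form a base of this topology, when `A` is finite). -/
instance instMeasurableSpace [DecidableEq A] : MeasurableSpace (Boundary A) :=
  MeasurableSpace.generateFrom (Set.range cylinder)

/-- A sequence of group elements converges to a boundary point: their reduced words converge
letter by letter. -/
def ConvergesTo [DecidableEq A] (g : ℕ → FreeGroup A) (ω : Boundary A) : Prop :=
  ∀ k, ∀ᶠ n in atTop, (g n).toWord.take k = ω.trunc k

end Boundary

/-! ### The uniform measure -/

section Uniform

variable {A : Type*} [Fintype A] [DecidableEq A]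

/-- The defining property of the uniform measure on the boundary of the free group of rank `m`:
it is a probability measure, and every cylinder `C_g` with `g ≠ e` has measure
`1 / (2m (2m-1)^(|g|-1))`. -/
structure IsUniform (μ : Measure (Boundary A)) : Prop where
  isProbabilityMeasure : IsProbabilityMeasure μ
  measure_cylinder : ∀ g : FreeGroup A, g ≠ 1 →
    μ (Boundary.cylinder g) =
      (2 * (Fintype.card A : ℝ≥0∞) * (2 * (Fintype.card A : ℝ≥0∞) - 1) ^ (g.norm - 1))⁻¹

theorem card_followers (a : Letter A) :
    Fintype.card {b : Letter A // b ≠ letterInv a} = 2 * Fintype.card A - 1 := by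
  rw [Fintype.card_subtype_compl, Fintype.card_subtype_eq, Fintype.card_prod, Fintype.card_bool,
    mul_comm]

/-- A numbering of the letters which may follow a given letter. -/
noncomputable def follower (a : Letter A) :
    Fin (2 * Fintype.card A - 1) ≃ {b : Letter A // b ≠ letterInv a} :=
  (Fintype.equivFinOfCardEq (card_followers a)).symm

/-- The infinite reduced word coded by its first letter and a sequence of digits. -/
noncomputable def decodeLetter (p : Letter A × (ℕ → Fin (2 * Fintype.card A - 1))) :
    ℕ → Letter A
  | 0 => p.1
  | n + 1 => (follower (decodeLetter p n) (p.2 n)).1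

/-- The boundary point coded by its first letter and a sequence of digits. -/
noncomputable def decode (p : Letter A × (ℕ → Fin (2 * Fintype.card A - 1))) : Boundary A where
  letter := decodeLetter p
  reduced n := (follower (decodeLetter p n) (p.2 n)).2

theorem decode_preimage [Nonempty A] (w : List (Letter A)) (hw : 0 < w.length)
    (hr : FreeGroup.IsReduced w) :
    ∃ (a : Letter A) (d : ℕ → Fin (2 * Fintype.card A - 1)),
      decode ⁻¹' {ω | ω.BeginsWith w} =
        {a} ×ˢ Set.pi (Finset.range (w.length - 1)) (fun i => {d i}) := by
  have hcard : 0 < Fintype.card A := Fintype.card_pos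
  have hr' : ∀ (i : ℕ) (hi : i + 1 < w.length), w[i + 1] ≠ letterInv w[i] := by
    intro i hi h
    have h1 := (List.isChain_iff_getElem.1 hr) i hi
    rw [h] at h1
    simp [letterInv] at h1
  refine ⟨w[0], fun i => if h : i + 1 < w.length then
    (follower w[i]).symm ⟨w[i + 1], hr' i h⟩ else ⟨0, by omega⟩, ?_⟩
  ext p
  simp only [Set.mem_preimage, Set.mem_ofPred_eq, Boundary.beginsWith_iff, Set.mem_prod,
    Set.mem_singleton_iff, Set.mem_pi, Finset.coe_range, Set.mem_Iio]
  constructor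
  · intro h
    refine ⟨h 0 hw, fun i hi => ?_⟩
    have hi' : i + 1 < w.length := by omega
    rw [dif_pos hi', Equiv.eq_symm_apply]
    apply Subtype.ext
    have h1 : decodeLetter p i = w[i] := h i (by omega)
    have h2 : (follower (decodeLetter p i) (p.2 i)).1 = w[i + 1] := h (i + 1) hi'
    rw [h1] at h2
    exact h2
  · rintro ⟨h0, h⟩ i
    induction i with
    | zero => intro hi; exact h0
    | succ i ih =>
      intro hi
      have h1 : decodeLetter p i = w[i] := ih (by omega)
      have h2 := h i (by omega)
      rw [dif_pos hi] at h2
      change (follower (decodeLetter p i) (p.2 i)).1 = w[i + 1]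
      rw [h1, h2, Equiv.apply_symm_apply]

theorem measurable_decode [Nonempty A] [MeasurableSpace (Letter A)]
    [MeasurableSingletonClass (Letter A)] : Measurable (decode (A := A)) := by
  apply measurable_generateFrom
  rintro _ ⟨g, rfl⟩
  by_cases hg : g = 1
  · subst hg
    rw [Boundary.cylinder_one]
    exact MeasurableSet.univ
  · obtain ⟨a, d, h⟩ := decode_preimage g.toWord
      (List.length_pos_iff.2 (fun h => hg (FreeGroup.toWord_eq_nil_iff.1 h)))
      FreeGroup.isReduced_toWord
    rw [Boundary.cylinder, h]
    exact (MeasurableSet.singleton a).prod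
      (MeasurableSet.pi (Finset.countable_toSet _) fun i _ => MeasurableSet.singleton _)

theorem exists_isUniform [Nonempty A] : ∃ μ : Measure (Boundary A), IsUniform μ := by
  have hcard : 0 < Fintype.card A := Fintype.card_pos
  have : Nonempty (Fin (2 * Fintype.card A - 1)) := ⟨⟨0, by omega⟩⟩
  let _ : MeasurableSpace (Letter A) := ⊤
  have : MeasurableSingletonClass (Letter A) := ⟨fun _ => trivial⟩
  let ν : Measure (Letter A) := (PMF.uniformOfFintype (Letter A)).toMeasure
  let κ : Measure (Fin (2 * Fintype.card A - 1)) := (PMF.uniformOfFintype _).toMeasure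
  have : IsProbabilityMeasure ν := PMF.toMeasure.isProbabilityMeasure _
  have : IsProbabilityMeasure κ := PMF.toMeasure.isProbabilityMeasure _
  refine ⟨(ν.prod (Measure.infinitePi fun _ : ℕ => κ)).map decode,
    Measure.isProbabilityMeasure_map measurable_decode.aemeasurable, fun g hg => ?_⟩
  obtain ⟨a, d, h⟩ := decode_preimage g.toWord
    (List.length_pos_iff.2 (fun h => hg (FreeGroup.toWord_eq_nil_iff.1 h)))
    FreeGroup.isReduced_toWord
  rw [Measure.map_apply measurable_decode
    (MeasurableSpace.measurableSet_generateFrom ⟨g, rfl⟩), Boundary.cylinder, h,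
    Measure.prod_prod, Measure.infinitePi_pi _ (fun i _ => MeasurableSet.singleton _)]
  have h1 : ν {a} = (2 * (Fintype.card A : ℝ≥0∞))⁻¹ := by
    rw [PMF.toMeasure_apply_singleton _ _ (MeasurableSet.singleton a),
      PMF.uniformOfFintype_apply, Fintype.card_prod, Fintype.card_bool]
    push_cast
    rw [mul_comm]
  have h2 : ∀ i, κ {d i} = (2 * (Fintype.card A : ℝ≥0∞) - 1)⁻¹ := by
    intro i
    rw [PMF.toMeasure_apply_singleton _ _ (MeasurableSet.singleton _),
      PMF.uniformOfFintype_apply, Fintype.card_fin]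
    push_cast
    rfl
  rw [h1, Finset.prod_congr rfl (fun i _ => h2 i), Finset.prod_const, Finset.card_range,
    ← ENNReal.inv_pow, ← ENNReal.mul_inv]
  · rfl
  · exact Or.inl (by simp)
  · exact Or.inl (ENNReal.mul_ne_top (by simp) (by simp))

theorem isPiSystem_cylinder : IsPiSystem (Set.range (Boundary.cylinder (A := A))) := by
  have key : ∀ (g h : FreeGroup A) (ω : Boundary A), g.toWord.length ≤ h.toWord.length →
      ω ∈ Boundary.cylinder g → ω ∈ Boundary.cylinder h →
      Boundary.cylinder h ⊆ Boundary.cylinder g := by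
    intro g h ω hl hg hh η hη
    simp only [Boundary.cylinder, Set.mem_ofPred_eq, Boundary.beginsWith_iff] at hg hh hη ⊢
    intro i hi
    rw [hη i (by omega), ← hh i (by omega), hg i hi]
  rintro _ ⟨g, rfl⟩ _ ⟨h, rfl⟩ ⟨ω, hg, hh⟩
  rcases le_total g.toWord.length h.toWord.length with hl | hl
  · exact ⟨h, (Set.inter_eq_right.2 (key g h ω hl hg hh)).symm⟩
  · exact ⟨g, (Set.inter_eq_left.2 (key h g ω hl hh hg)).symm⟩

theorem existsUnique_isUniform [Nonempty A] : ∃! μ : Measure (Boundary A), IsUniform μ := by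
  obtain ⟨μ, hμ⟩ := exists_isUniform (A := A)
  refine ⟨μ, hμ, fun ν hν => ?_⟩
  have := hμ.isProbabilityMeasure
  have := hν.isProbabilityMeasure
  refine ext_of_generate_finite _ rfl isPiSystem_cylinder ?_ (by simp)
  rintro _ ⟨g, rfl⟩
  by_cases hg : g = 1
  · subst hg
    simp [Boundary.cylinder_one]
  · rw [hμ.measure_cylinder g hg, hν.measure_cylinder g hg]

/-- The uniform measure on the boundary: the unique probability measure for which
all cylinders `C_g` with `|g| = n ≥ 1` have measure `1 / (2m (2m-1)^(n-1))`. -/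
noncomputable def uniformMeasure (A : Type*) [Fintype A] [DecidableEq A] [Nonempty A] :
    Measure (Boundary A) :=
  (existsUnique_isUniform (A := A)).choose

theorem uniformMeasure_isUniform [Nonempty A] : IsUniform (uniformMeasure A) :=
  (existsUnique_isUniform (A := A)).choose_spec.1

end Uniform

/-! ### The Schreier graph and its spanning trees -/

section Schreier

variable {A : Type*}

/-- The vertices of the Schreier graph: the right cosets `Hg`. -/
abbrev Vertex (H : Subgroup (FreeGroup A)) := Quotient (QuotientGroup.rightRel H)

variable {H : Subgroup (FreeGroup A)}

/-- The coset `Hg`. -/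
def coset (H : Subgroup (FreeGroup A)) (g : FreeGroup A) : Vertex H := Quotient.mk'' g

/-- The endpoint `Hga` of the edge labelled `a` issued from the vertex `Hg`. -/
def step (x : Vertex H) (a : Letter A) : Vertex H :=
  Quotient.map' (fun g => g * letterElt a) (fun g g' h => by
    rw [QuotientGroup.rightRel_apply] at h ⊢
    simpa [mul_assoc] using h) x

/-- The oriented edges of the Schreier graph, recorded as the initial vertex together with the
label: `(x, a)` is the edge labelled `a` from `x` to `step x a`. There is one edge for each vertex
and each letter, so that loops and multiple edges are allowed. -/
abbrev Edge (H : Subgroup (FreeGroup A)) := Vertex H × Letter A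

/-- The same edge with the opposite orientation. -/
def Edge.reverse (e : Edge H) : Edge H := (step e.1 e.2, letterInv e.2)

/-- Reading the labels of the word `w` from the vertex `x` gives a path which only uses edges
from the set `T` and which ends at the vertex `y`. -/
def IsPath (T : Set (Edge H)) : Vertex H → List (Letter A) → Vertex H → Prop
  | x, [], y => x = y
  | x, a :: w, y => (x, a) ∈ T ∧ IsPath T (step x a) w y

/-- A set of oriented edges is (the edge set of) a spanning tree of the Schreier graph if
it is invariant under reversal and any two vertices of the graph are joined by a unique path
without backtracking in it. A path has no backtracking if and only if its word is reduced. -/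
structure IsSpanningTree (T : Set (Edge H)) : Prop where
  reverse_mem : ∀ e ∈ T, Edge.reverse e ∈ T
  existsUnique_path : ∀ x y : Vertex H, ∃! w, FreeGroup.IsReduced w ∧ IsPath T x w y

/-- The graph distance in the subgraph with edge set `T`. -/
noncomputable def graphDist (T : Set (Edge H)) (x y : Vertex H) : ℕ :=
  sInf {n | ∃ w, w.length = n ∧ IsPath T x w y}

/-- A geodesic spanning tree of the Schreier graph, rooted at the vertex `o = H`. -/
structure IsGeodesicSpanningTree (T : Set (Edge H)) : Prop extends IsSpanningTree T where
  dist_eq : ∀ x, graphDist T (coset H 1) x = graphDist Set.univ (coset H 1) x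

variable [DecidableEq A]

/-- The Schreier transversal of a spanning tree: the elements whose reduced words are read along
the paths in the tree issued from `o = H`. -/
def transversal (T : Set (Edge H)) : Set (FreeGroup A) :=
  {g | IsPath T (coset H 1) g.toWord (coset H g)}

/-- The Schreier generators and their inverses: for every oriented edge `[x, y]` labelled `a`
which is not in the tree, the element read along `[o, x]_T [x, y] [y, o]_T`. -/
def schreierGenerators (T : Set (Edge H)) : Set (FreeGroup A) :=
  {s | ∃ g ∈ transversal T, ∃ a : Letter A, ∃ g' ∈ transversal T,
    (coset H g, a) ∉ T ∧ step (coset H g) a = coset H g' ∧ s = g * letterElt a * g'⁻¹}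

/-- The Schreier limit set `Ω`: the limits of the products `s₁ s₂ ⋯ sₙ` along infinite reduced
words `s₁ s₂ ⋯` in the Schreier generators and their inverses. -/
def schreierLimitSet (T : Set (Edge H)) : Set (Boundary A) :=
  {ω | ∃ s : ℕ → FreeGroup A, (∀ n, s n ∈ schreierGenerators T) ∧
    (∀ n, s (n + 1) ≠ (s n)⁻¹) ∧
    Boundary.ConvergesTo (fun n => ((List.range n).map s).prod) ω}

/-- The Schreier fundamental domain `Δ`: the infinite words which do not begin with the word
of `[o, x]_T [x, y]` for any oriented edge `[x, y]` not in the tree. -/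
def schreierDomain (T : Set (Edge H)) : Set (Boundary A) :=
  {ω | ∀ g ∈ transversal T, ∀ a : Letter A, (coset H g, a) ∉ T →
    ¬ ω.BeginsWith (g.toWord ++ [a])}

end Schreier

/-! ### The Hopf decomposition -/

section Hopf

variable (G : Type*) [Group G] {X : Type*} [MulAction G X] [MeasurableSpace X] (μ : Measure X)

/-- Almost every point of `B` returns to `B` under some non-trivial group element. -/
def IsRecurrentSet (B : Set X) : Prop :=
  ∀ᵐ x ∂μ, x ∈ B → ∃ g : G, g ≠ 1 ∧ g • x ∈ B

/-- The translates of `B` are pairwise disjoint (mod 0). -/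
def IsWanderingSet (B : Set X) : Prop :=
  Pairwise fun g h : G => AEDisjoint μ (g • B) (h • B)

/-- `X = C ⊔ D` is (mod 0) the Hopf decomposition: `C` and `D` are measurable invariant sets,
the action on `C` is conservative (every measurable subset of positive measure is recurrent), and
the action on `D` is completely dissipative (`D` is the union of the translates of a wandering
set). -/
structure IsHopfDecomposition (C D : Set X) : Prop where
  measurableSet_conservative : MeasurableSet C
  measurableSet_dissipative : MeasurableSet D
  disjoint : AEDisjoint μ C D
  union : (C ∪ D : Set X) =ᵐ[μ] Set.univ
  smul_conservative : ∀ g : G, (g • C : Set X) =ᵐ[μ] C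
  smul_dissipative : ∀ g : G, (g • D : Set X) =ᵐ[μ] D
  conservative : ∀ B ⊆ C, MeasurableSet B → 0 < μ B → IsRecurrentSet G μ B
  dissipative : ∃ W : Set X, MeasurableSet W ∧ IsWanderingSet G μ W ∧
    (⋃ g : G, g • W : Set X) =ᵐ[μ] D

end Hopf

end FreeBoundary

namespace FreeBoundary

/-! ### Reduced words and paths in the Schreier graph -/

section Paths

variable {A : Type*}

/-! An infinite word ω traces a path from the root in the Schreier graph; `pathEdge H ω n` is its
n-th edge. Everything is read off from when this path leaves the tree `T`. A point lies in Δ iff its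
path never leaves `T` (`mem_schreierDomain_iff`). An element of `H` changes only a finite prefix and
does not change cosets, so points of one `H`-orbit eventually run along the same edges; hence the
translates of Δ make up the points that leave `T` finitely often
(`mem_iUnion_smul_schreierDomain_iff`). The off-tree edges crossed by ω spell its expansion in the
Schreier generators, so Ω is the set of points that leave `T` infinitely often
(`mem_schreierLimitSet_iff`). The two sets are therefore complementary. The translates of Δ are
disjoint because prefixes of points of Δ belong to the transversal, which has one element in each
coset.

For conservativity, let `W` ⊂ Ω be disjoint from its non-trivial translates. For each reduced word u
ending with an off-tree edge, `loopElt` u ∈ `H` is u followed by the return to the root along the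
tree. Its inverse replaces the prefix u by the tree word of the same vertex. As the tree is
geodesic, this word is not longer than u, so the measure of `W` ∩ C_u does not decrease
(`IsUniform.measure_le_of_beginsWith`). Distinct u have distinct loop elements (`loopElt_inj`), so
the images are disjoint and the measures of all `W` ∩ C_u have a finite sum. By Borel–Cantelli
almost every point of `W` lies in finitely many C_u, whereas a point of Ω lies in infinitely many;
thus `W` is null (`IsUniform.measure_eq_zero_of_wandering`). Uniqueness mod 0 follows since a set
which is both recurrent and wandering is null, and the action is nonsingular. -/

theorem reduced_rel_iff (a b : Letter A) : (a.1 = b.1 → a.2 = b.2) ↔ b ≠ letterInv a := by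
  obtain ⟨a, s⟩ := a
  obtain ⟨b, t⟩ := b
  cases s <;> cases t <;> simp [letterInv, eq_comm]

theorem isReduced_append_cons {u v : List (Letter A)} {a b : Letter A}
    (hu : FreeGroup.IsReduced (u ++ [a])) (hv : FreeGroup.IsReduced (b :: v))
    (hab : b ≠ letterInv a) : FreeGroup.IsReduced (u ++ [a] ++ b :: v) := by
  have h : FreeGroup.IsReduced (u ++ a :: b :: v) :=
    List.isChain_append_cons_cons.2 ⟨hu, (reduced_rel_iff a b).2 hab, hv⟩
  simpa using h

theorem mk_append (u v : List (Letter A)) :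
    FreeGroup.mk (u ++ v) = FreeGroup.mk u * FreeGroup.mk v :=
  FreeGroup.mul_mk.symm

theorem letterElt_letterInv (a : Letter A) : letterElt (letterInv a) = (letterElt a)⁻¹ := by
  simp [letterElt, letterInv, FreeGroup.invRev]

theorem isReduced_invRev [DecidableEq A] {w : List (Letter A)} (h : FreeGroup.IsReduced w) :
    FreeGroup.IsReduced (FreeGroup.invRev w) := by
  rw [FreeGroup.isReduced_iff_reduce_eq] at h ⊢
  rw [FreeGroup.reduce_invRev, h]

variable {H : Subgroup (FreeGroup A)} {T : Set (Edge H)}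

theorem step_coset (g : FreeGroup A) (a : Letter A) :
    step (coset H g) a = coset H (g * letterElt a) := rfl

theorem coset_surjective (x : Vertex H) : ∃ g, coset H g = x :=
  Quotient.inductionOn' x fun g => ⟨g, rfl⟩

theorem coset_eq_iff {g g' : FreeGroup A} : coset H g = coset H g' ↔ g' * g⁻¹ ∈ H := by
  unfold coset
  rw [Quotient.eq'', QuotientGroup.rightRel_apply]

theorem coset_mul_of_mem {h : FreeGroup A} (hh : h ∈ H) (g : FreeGroup A) :
    coset H (h * g) = coset H g := by
  rw [coset_eq_iff]
  simpa using H.inv_mem hh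

theorem step_step_inv (x : Vertex H) (a : Letter A) : step (step x a) (letterInv a) = x := by
  obtain ⟨g, rfl⟩ := coset_surjective x
  simp [step_coset, letterElt_letterInv]

theorem isPath_append {x z : Vertex H} {u v : List (Letter A)} :
    IsPath T x (u ++ v) z ↔ ∃ y, IsPath T x u y ∧ IsPath T y v z := by
  induction u generalizing x with
  | nil => simp [IsPath]
  | cons a u ih => simp [IsPath, ih, and_assoc]

theorem IsPath.eq_coset {g : FreeGroup A} {w : List (Letter A)} {y : Vertex H}
    (h : IsPath T (coset H g) w y) : y = coset H (g * FreeGroup.mk w) := by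
  induction w generalizing g with
  | nil =>
    rw [← FreeGroup.one_eq_mk, mul_one]
    exact h.symm
  | cons a w ih =>
    rw [ih h.2, ← List.singleton_append, mk_append, ← mul_assoc]
    rfl

theorem isPath_univ (g : FreeGroup A) (w : List (Letter A)) :
    IsPath Set.univ (coset H g) w (coset H (g * FreeGroup.mk w)) := by
  induction w generalizing g with
  | nil =>
    rw [← FreeGroup.one_eq_mk, mul_one]
    rfl
  | cons a w ih =>
    refine ⟨trivial, ?_⟩
    rw [← List.singleton_append, mk_append, ← mul_assoc]
    exact ih _

/-- A cancelling pair of letters goes along an edge and straight back, so deleting it leaves a path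
with the same ends. Hence free reduction never takes a path out of the tree. -/
theorem IsPath.of_step {x y : Vertex H} {w w' : List (Letter A)} (h : IsPath T x w y)
    (hw : FreeGroup.Red.Step w w') : IsPath T x w' y := by
  obtain @⟨u, v, a, b⟩ := hw
  obtain ⟨z, hu, hz⟩ := isPath_append.1 h
  refine isPath_append.2 ⟨z, hu, ?_⟩
  have := hz.2.2
  rwa [show (a, !b) = letterInv (a, b) from rfl, step_step_inv] at this

theorem IsPath.of_red {x y : Vertex H} {w w' : List (Letter A)} (h : IsPath T x w y)
    (hw : FreeGroup.Red w w') : IsPath T x w' y := by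
  induction hw with
  | refl => exact h
  | tail _ hs ih => exact ih.of_step hs

theorem IsPath.reduce [DecidableEq A] {x y : Vertex H} {w : List (Letter A)}
    (h : IsPath T x w y) : IsPath T x (FreeGroup.reduce w) y :=
  h.of_red FreeGroup.reduce.red

theorem IsSpanningTree.reverse_mem_iff (hT : IsSpanningTree T) (x : Vertex H) (a : Letter A) :
    (step x a, letterInv a) ∈ T ↔ (x, a) ∈ T := by
  refine ⟨fun h => ?_, fun h => hT.reverse_mem _ h⟩
  have := hT.reverse_mem _ h
  rwa [Edge.reverse, step_step_inv, letterInv_letterInv] at this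

theorem IsPath.invRev (hT : IsSpanningTree T) {x y : Vertex H} {w : List (Letter A)}
    (h : IsPath T x w y) : IsPath T y (FreeGroup.invRev w) x := by
  induction w generalizing x with
  | nil => exact h.symm
  | cons a w ih =>
    rw [FreeGroup.invRev_cons]
    exact isPath_append.2 ⟨_, ih h.2, (hT.reverse_mem_iff x a).2 h.1, step_step_inv x a⟩

/-! ### The transversal -/

/-- The word read along the path in the tree from the root to a vertex. -/
noncomputable def treeWord (hT : IsSpanningTree T) (x : Vertex H) : List (Letter A) :=
  (hT.existsUnique_path (coset H 1) x).choose

theorem treeWord_isReduced (hT : IsSpanningTree T) (x : Vertex H) :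
    FreeGroup.IsReduced (treeWord hT x) :=
  (hT.existsUnique_path (coset H 1) x).choose_spec.1.1

theorem treeWord_isPath (hT : IsSpanningTree T) (x : Vertex H) :
    IsPath T (coset H 1) (treeWord hT x) x :=
  (hT.existsUnique_path (coset H 1) x).choose_spec.1.2

theorem eq_treeWord (hT : IsSpanningTree T) {x : Vertex H} {w : List (Letter A)}
    (hw : FreeGroup.IsReduced w) (h : IsPath T (coset H 1) w x) : w = treeWord hT x :=
  (hT.existsUnique_path (coset H 1) x).choose_spec.2 w ⟨hw, h⟩

/-- The representative of a vertex in the transversal. -/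
noncomputable def treeElt (hT : IsSpanningTree T) (x : Vertex H) : FreeGroup A :=
  FreeGroup.mk (treeWord hT x)

theorem coset_treeElt (hT : IsSpanningTree T) (x : Vertex H) : coset H (treeElt hT x) = x := by
  have := (treeWord_isPath hT x).eq_coset
  rw [one_mul] at this
  exact this.symm

variable [DecidableEq A]

theorem toWord_treeElt (hT : IsSpanningTree T) (x : Vertex H) :
    (treeElt hT x).toWord = treeWord hT x := by
  rw [treeElt, FreeGroup.toWord_mk, (treeWord_isReduced hT x).reduce_eq]

theorem treeElt_mem_transversal (hT : IsSpanningTree T) (x : Vertex H) :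
    treeElt hT x ∈ transversal T := by
  rw [transversal, Set.mem_ofPred_eq, toWord_treeElt, coset_treeElt]
  exact treeWord_isPath hT x

theorem eq_treeElt (hT : IsSpanningTree T) {g : FreeGroup A} (hg : g ∈ transversal T) :
    g = treeElt hT (coset H g) := by
  rw [treeElt, ← eq_treeWord hT FreeGroup.isReduced_toWord hg, FreeGroup.mk_toWord]

/-- The tree word of `x` followed by `w` is a tree path to `y`; its reduction is again a tree path,
hence the tree word of `y` by uniqueness. -/
theorem treeElt_mul_mk (hT : IsSpanningTree T) {x y : Vertex H} {w : List (Letter A)}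
    (h : IsPath T x w y) : treeElt hT x * FreeGroup.mk w = treeElt hT y := by
  have h1 : IsPath T (coset H 1) (treeWord hT x ++ w) y :=
    isPath_append.2 ⟨x, treeWord_isPath hT x, h⟩
  have h2 : (FreeGroup.mk (treeWord hT x ++ w)).toWord = treeWord hT y :=
    eq_treeWord hT FreeGroup.isReduced_toWord
      (by simpa only [FreeGroup.toWord_mk] using h1.reduce)
  rw [treeElt, treeElt, ← h2, FreeGroup.mk_toWord, mk_append]

theorem treeElt_mul_letterElt (hT : IsSpanningTree T) {x : Vertex H} {a : Letter A}
    (h : (x, a) ∈ T) : treeElt hT x * letterElt a = treeElt hT (step x a) :=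
  treeElt_mul_mk hT (w := [a]) ⟨h, rfl⟩

theorem length_treeWord_le_of_isPath (hT : IsSpanningTree T) {x : Vertex H}
    {w : List (Letter A)} (h : IsPath T (coset H 1) w x) :
    (treeWord hT x).length ≤ w.length := by
  have h1 : FreeGroup.reduce w = treeWord hT x := by
    rw [← FreeGroup.toWord_mk]
    exact eq_treeWord hT FreeGroup.isReduced_toWord
      (by simpa only [FreeGroup.toWord_mk] using h.reduce)
  rw [← h1]
  exact FreeGroup.Red.length_le FreeGroup.reduce.red

/-- This is the only place where the equality of tree and graph distances enters: `w` is a path in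
the whole graph to the same vertex, and a shortest tree path reduces to the tree word. -/
theorem length_treeWord_le (hT : IsGeodesicSpanningTree T) (w : List (Letter A)) :
    (treeWord hT.toIsSpanningTree (coset H (FreeGroup.mk w))).length ≤ w.length := by
  have h1 : graphDist T (coset H 1) (coset H (FreeGroup.mk w)) ≤ w.length := by
    rw [hT.dist_eq]
    refine Nat.sInf_le ⟨w, rfl, ?_⟩
    simpa only [one_mul] using isPath_univ (H := H) 1 w
  obtain ⟨v, hv, hp⟩ := Nat.sInf_mem
    (s := {n | ∃ v, v.length = n ∧ IsPath T (coset H 1) v (coset H (FreeGroup.mk w))})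
    ⟨_, _, rfl, treeWord_isPath hT.toIsSpanningTree _⟩
  calc _ ≤ v.length := length_treeWord_le_of_isPath _ hp
    _ = graphDist T (coset H 1) (coset H (FreeGroup.mk w)) := hv
    _ ≤ _ := h1

/-! ### Words whose last edge is not in the tree -/

/-- The path of the word `u` issued from the root ends with an edge outside of the tree. -/
def EndsOff (T : Set (Edge H)) (u : List (Letter A)) : Prop :=
  ∃ v a, u = v ++ [a] ∧ (coset H (FreeGroup.mk v), a) ∉ T

-- If the first letter of `p` cancelled the last letter of `u`, its edge would be the reverse of an
-- off-tree edge, whereas `p` stays in the tree.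
omit [DecidableEq A] in
theorem EndsOff.isReduced_append (hT : IsSpanningTree T) {u p : List (Letter A)} {y : Vertex H}
    (hu : FreeGroup.IsReduced u) (ho : EndsOff T u) (hp : FreeGroup.IsReduced p)
    (h : IsPath T (coset H (FreeGroup.mk u)) p y) : FreeGroup.IsReduced (u ++ p) := by
  obtain ⟨v, a, rfl, hva⟩ := ho
  cases p with
  | nil => simpa using hu
  | cons b p =>
    refine isReduced_append_cons hu hp ?_
    rintro rfl
    apply hva
    rw [← hT.reverse_mem_iff, step_coset]
    have := h.1
    rwa [mk_append] at this

/-- The element of the subgroup obtained by returning to the root along the tree after reading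
the word `u`. -/
noncomputable def loopElt (hT : IsSpanningTree T) (u : List (Letter A)) : FreeGroup A :=
  FreeGroup.mk u * (treeElt hT (coset H (FreeGroup.mk u)))⁻¹

omit [DecidableEq A] in
theorem loopElt_mem (hT : IsSpanningTree T) (u : List (Letter A)) : loopElt hT u ∈ H := by
  rw [loopElt, ← coset_eq_iff, coset_treeElt]

theorem toWord_loopElt (hT : IsSpanningTree T) {u : List (Letter A)}
    (hu : FreeGroup.IsReduced u) (ho : EndsOff T u) :
    (loopElt hT u).toWord =
      u ++ FreeGroup.invRev (treeWord hT (coset H (FreeGroup.mk u))) := by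
  rw [loopElt, treeElt, FreeGroup.inv_mk, ← mk_append, FreeGroup.toWord_mk]
  exact (ho.isReduced_append hT hu (isReduced_invRev (treeWord_isReduced hT _))
    ((treeWord_isPath hT _).invRev hT)).reduce_eq

/-- The reduced word of the loop element is `u` followed by a tree path, so `u` is recovered as the
prefix up to the last off-tree edge. -/
theorem loopElt_inj (hT : IsSpanningTree T) {u u' : List (Letter A)}
    (hu : FreeGroup.IsReduced u) (ho : EndsOff T u) (hu' : FreeGroup.IsReduced u')
    (ho' : EndsOff T u') (h : loopElt hT u = loopElt hT u') : u = u' := by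
  wlog hl : u.length ≤ u'.length generalizing u u'
  · exact (this hu' ho' hu ho h.symm (by omega)).symm
  have h1 : u ++ FreeGroup.invRev (treeWord hT (coset H (FreeGroup.mk u))) =
      u' ++ FreeGroup.invRev (treeWord hT (coset H (FreeGroup.mk u'))) := by
    rw [← toWord_loopElt hT hu ho, ← toWord_loopElt hT hu' ho', h]
  obtain ⟨p, rfl⟩ := List.prefix_of_prefix_length_le
    (List.prefix_append u _) (h1 ▸ List.prefix_append u' _) hl
  obtain ⟨v, a, hva, hoff⟩ := ho'
  rcases List.eq_nil_or_concat p with rfl | ⟨q, b, rfl⟩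
  · simp
  -- If `u` is a proper prefix of `u'`, the last edge of `u'` lies on the return path of `u`, hence
  -- in the tree.
  · exfalso
    rw [List.concat_eq_append, ← List.append_assoc] at hva
    obtain ⟨rfl, h2⟩ := List.append_inj' hva rfl
    obtain rfl : b = a := by simpa using h2
    rw [List.append_assoc, List.append_cancel_left_eq] at h1
    have h3 := (treeWord_isPath hT (coset H (FreeGroup.mk u))).invRev hT
    rw [h1, List.concat_eq_append, List.append_assoc] at h3
    obtain ⟨y, hq, hb⟩ := isPath_append.1 h3
    apply hoff
    rw [mk_append, ← hq.eq_coset]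
    exact hb.1

-- Mirror image of `EndsOff.isReduced_append`: an off-tree edge cannot undo the last edge of a
-- nonempty tree path.
omit [DecidableEq A] in
theorem isReduced_concat_of_notMem (hT : IsSpanningTree T) {u p : List (Letter A)}
    (h : FreeGroup.IsReduced (u ++ p)) (hp : p ≠ []) {x y : Vertex H} (hpath : IsPath T y p x)
    {b : Letter A} (hb : (x, b) ∉ T) : FreeGroup.IsReduced (u ++ p ++ [b]) := by
  obtain ⟨q, c, rfl⟩ := (List.eq_nil_or_concat p).resolve_left hp
  rw [List.concat_eq_append] at h hpath ⊢
  rw [← List.append_assoc] at h ⊢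
  refine isReduced_append_cons h .singleton ?_
  rintro rfl
  obtain ⟨y, -, hc, rfl⟩ := isPath_append.1 hpath
  exact hb ((hT.reverse_mem_iff y c).2 hc)

/-- One step in spelling a product of generators. The tree path `p` joins the end of one off-tree
edge to the start of the next. Cancellation is possible only when `p` is empty, and then `hne`
excludes it. -/
theorem EndsOff.exists_extension (hT : IsSpanningTree T) {v : List (Letter A)} {a : Letter A}
    (hv : FreeGroup.IsReduced (v ++ [a])) (ho : (coset H (FreeGroup.mk v), a) ∉ T)
    {x : Vertex H} {b : Letter A} (hb : (x, b) ∉ T)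
    (hne : (x, b) ≠ Edge.reverse (coset H (FreeGroup.mk v), a)) :
    ∃ p, FreeGroup.IsReduced (v ++ [a] ++ p ++ [b]) ∧
      FreeGroup.mk (v ++ [a] ++ p) = loopElt hT (v ++ [a]) * treeElt hT x := by
  obtain ⟨p, ⟨hp, hpath⟩, -⟩ := hT.existsUnique_path (coset H (FreeGroup.mk (v ++ [a]))) x
  refine ⟨p, ?_, ?_⟩
  · by_cases hnil : p = []
    · subst hnil
      rw [List.append_nil]
      refine isReduced_append_cons hv .singleton ?_
      rintro rfl
      apply hne
      rw [Edge.reverse, Prod.mk.injEq]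
      refine ⟨?_, rfl⟩
      rw [← show coset H (FreeGroup.mk (v ++ [a])) = x from hpath, step_coset, mk_append]
      rfl
    · exact isReduced_concat_of_notMem hT
        (EndsOff.isReduced_append hT hv ⟨v, a, rfl, ho⟩ hp hpath) hnil hpath hb
  · rw [← treeElt_mul_mk hT hpath, loopElt, mk_append _ p]
    group

end Paths

/-! ### Initial segments and tails of infinite words -/

namespace Boundary

variable {A : Type*}

theorem length_trunc (ω : Boundary A) (n : ℕ) : (ω.trunc n).length = n := by simp [trunc]

theorem trunc_zero (ω : Boundary A) : ω.trunc 0 = [] := rfl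

theorem trunc_succ (ω : Boundary A) (n : ℕ) : ω.trunc (n + 1) = ω.trunc n ++ [ω.letter n] := by
  simp [trunc, List.range_succ]

theorem trunc_isReduced (ω : Boundary A) (n : ℕ) : FreeGroup.IsReduced (ω.trunc n) := by
  refine List.isChain_iff_getElem.2 fun i hi => ?_
  rw [reduced_rel_iff]
  simpa [trunc] using ω.reduced i

theorem toWord_mk_trunc [DecidableEq A] (ω : Boundary A) (n : ℕ) :
    (FreeGroup.mk (ω.trunc n)).toWord = ω.trunc n := by
  rw [FreeGroup.toWord_mk, (ω.trunc_isReduced n).reduce_eq]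

/-- Removing the first `n` letters. -/
def drop (ω : Boundary A) (n : ℕ) : Boundary A where
  letter k := ω.letter (n + k)
  reduced k := ω.reduced (n + k)

theorem drop_drop (ω : Boundary A) (m n : ℕ) : (ω.drop m).drop n = ω.drop (m + n) := by
  ext1
  funext k
  simp [drop, add_assoc]

theorem trunc_add (ω : Boundary A) (m n : ℕ) :
    ω.trunc (m + n) = ω.trunc m ++ (ω.drop m).trunc n := by
  induction n with
  | zero => simp [trunc_zero]
  | succ n ih => rw [← add_assoc, trunc_succ, ih, trunc_succ, List.append_assoc]; rfl

theorem take_trunc (ω : Boundary A) {m n : ℕ} (h : m ≤ n) : (ω.trunc n).take m = ω.trunc m := by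
  obtain ⟨k, rfl⟩ := Nat.exists_eq_add_of_le h
  rw [trunc_add, List.take_left' (ω.length_trunc m)]

theorem BeginsWith.of_append {ω : Boundary A} {u v : List (Letter A)}
    (h : ω.BeginsWith (u ++ v)) : ω.BeginsWith u := by
  have h1 := congrArg (List.take u.length) h
  rwa [List.length_append, take_trunc _ (Nat.le_add_right _ _), List.take_left] at h1

theorem BeginsWith.letter_eq {ω : Boundary A} {u : List (Letter A)} {a : Letter A}
    (h : ω.BeginsWith (u ++ [a])) : ω.letter u.length = a := by
  have h1 := (beginsWith_iff ω _).1 h u.length (by simp)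
  simpa using h1

variable [DecidableEq A]

omit [DecidableEq A] in
theorem drop_smul_tail {ω η : Boundary A} {i j : ℕ} {g : FreeGroup A}
    (h : η.drop i = ω.drop j) (hg : FreeGroup.mk (η.trunc i) = g * FreeGroup.mk (ω.trunc j))
    (k : ℕ) : η.drop (i + k) = ω.drop (j + k) ∧
      FreeGroup.mk (η.trunc (i + k)) = g * FreeGroup.mk (ω.trunc (j + k)) := by
  constructor
  · rw [← drop_drop, h, drop_drop]
  · rw [trunc_add, mk_append, hg, h, trunc_add, mk_append, mul_assoc]

/-- A boundary point and its image under a group element have a common tail. -/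
theorem exists_drop_smul_eq (g : FreeGroup A) (ω : Boundary A) :
    ∃ i j, (g • ω).drop i = ω.drop j ∧
      FreeGroup.mk ((g • ω).trunc i) = g * FreeGroup.mk (ω.trunc j) := by
  obtain ⟨w, rfl⟩ : ∃ w, FreeGroup.mk w = g := ⟨_, FreeGroup.mk_toWord⟩
  induction w with
  | nil => exact ⟨0, 0, by simp [← FreeGroup.one_eq_mk]⟩
  | cons a w ih =>
    obtain ⟨i, j, h1, h2⟩ := ih
    -- Lengthening both prefixes by one letter makes the prefix of `FreeGroup.mk w • ω` nonempty, so
    -- that it contains the letter which `a` may cancel.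
    obtain ⟨h1, h2⟩ := drop_smul_tail h1 h2 1
    have hg : FreeGroup.mk (a :: w) = letterElt a * FreeGroup.mk w := by
      rw [← List.singleton_append, mk_append]
      rfl
    rw [hg, mul_smul, letterElt_smul]
    generalize FreeGroup.mk w • ω = η at h1 h2
    by_cases h : η.letter 0 = letterInv a
    · refine ⟨i, j + 1, ?_, ?_⟩
      · rw [← h1, mulLetter, dif_pos h]
        ext1
        funext k
        simp [drop, tail, add_right_comm]
      · rw [mul_assoc, ← h2, mulLetter, dif_pos h, add_comm i 1, trunc_add, mk_append,
          trunc_succ, trunc_zero, List.nil_append, h]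
        change _ = letterElt a * (letterElt (letterInv a) * FreeGroup.mk ((η.drop 1).trunc i))
        rw [letterElt_letterInv, mul_inv_cancel_left]
        congr 2
        ext1
        funext k
        simp [drop, tail, add_comm]
    · refine ⟨1 + (i + 1), j + 1, ?_, ?_⟩
      · rw [← h1, mulLetter, dif_neg h]
        ext1
        funext k
        have : 1 + (i + 1) + k = i + 1 + k + 1 := by omega
        simp [drop, cons, this]
      · rw [mul_assoc, ← h2, mulLetter, dif_neg h, trunc_add, mk_append]
        congr 2
        congr 1
        ext1
        funext k
        simp [drop, cons, add_comm 1]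

end Boundary

/-! ### The path of an infinite word in the Schreier graph -/

section Crossings

variable {A : Type*} {H : Subgroup (FreeGroup A)} {T : Set (Edge H)}

/-- The `n`-th edge of the path issued from the root along an infinite word. -/
def pathEdge (H : Subgroup (FreeGroup A)) (ω : Boundary A) (n : ℕ) : Edge H :=
  (coset H (FreeGroup.mk (ω.trunc n)), ω.letter n)

theorem step_pathEdge (ω : Boundary A) (n : ℕ) :
    step (pathEdge H ω n).1 (pathEdge H ω n).2 = coset H (FreeGroup.mk (ω.trunc (n + 1))) := by
  rw [Boundary.trunc_succ, mk_append]
  rfl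

theorem endsOff_trunc_succ {ω : Boundary A} {n : ℕ} (h : pathEdge H ω n ∉ T) :
    EndsOff T (ω.trunc (n + 1)) :=
  ⟨_, _, ω.trunc_succ n, h⟩

theorem pathEdge_of_beginsWith {ω : Boundary A} {u : List (Letter A)} {a : Letter A}
    (h : ω.BeginsWith (u ++ [a])) :
    pathEdge H ω u.length = (coset H (FreeGroup.mk u), a) := by
  rw [pathEdge, h.of_append, h.letter_eq]

theorem isPath_trunc_iff (ω : Boundary A) (n : ℕ) :
    IsPath T (coset H 1) (ω.trunc n) (coset H (FreeGroup.mk (ω.trunc n))) ↔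
      ∀ k < n, pathEdge H ω k ∈ T := by
  induction n with
  | zero => simp [Boundary.trunc_zero, IsPath, FreeGroup.one_eq_mk]
  | succ n ih =>
    rw [Nat.forall_lt_succ_right, ← ih, ← step_pathEdge, Boundary.trunc_succ, isPath_append]
    constructor
    · rintro ⟨y, hy, h, -⟩
      obtain rfl : y = coset H (FreeGroup.mk (ω.trunc n)) := by
        have := IsPath.eq_coset hy
        rwa [one_mul] at this
      exact ⟨hy, h⟩
    · rintro ⟨h1, h2⟩
      exact ⟨_, h1, h2, rfl⟩

/-- The forbidden words are the ones whose only off-tree edge is the last. If the path leaves the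
tree, its prefix up to the first exit is such a word. -/
theorem mem_schreierDomain_iff [DecidableEq A] (ω : Boundary A) :
    ω ∈ schreierDomain T ↔ ∀ n, pathEdge H ω n ∈ T := by
  constructor
  · intro h n
    induction n using Nat.strong_induction_on with
    | _ n ih =>
      by_contra hn
      refine h (FreeGroup.mk (ω.trunc n)) ?_ (ω.letter n) hn ?_
      · rw [transversal, Set.mem_ofPred_eq, ω.toWord_mk_trunc]
        exact (isPath_trunc_iff ω n).2 ih
      · rw [ω.toWord_mk_trunc, ← ω.trunc_succ, Boundary.BeginsWith, ω.length_trunc]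
  · intro h g _ a ha hω
    have h1 := pathEdge_of_beginsWith (H := H) hω
    rw [FreeGroup.mk_toWord] at h1
    exact ha (h1 ▸ h _)

theorem trunc_eq_treeWord (hT : IsSpanningTree T) {ω : Boundary A} {n : ℕ}
    (h : ∀ k < n, pathEdge H ω k ∈ T) :
    ω.trunc n = treeWord hT (coset H (FreeGroup.mk (ω.trunc n))) :=
  eq_treeWord hT (ω.trunc_isReduced n) ((isPath_trunc_iff ω n).2 h)

theorem mk_trunc_eq_treeElt (hT : IsSpanningTree T) {ω : Boundary A} {n : ℕ}
    (h : ∀ k < n, pathEdge H ω k ∈ T) :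
    FreeGroup.mk (ω.trunc n) = treeElt hT (coset H (FreeGroup.mk (ω.trunc n))) :=
  congrArg FreeGroup.mk (trunc_eq_treeWord hT h)

/-- Left multiplication by an element of `H` fixes every coset `Hg`, so equal tails traced from
matching prefixes use the same edges. -/
theorem pathEdge_eq_of_drop_eq {ω η : Boundary A} {i j : ℕ} {g : FreeGroup A} (hg : g ∈ H)
    (h : η.drop i = ω.drop j) (h' : FreeGroup.mk (η.trunc i) = g * FreeGroup.mk (ω.trunc j))
    (k : ℕ) : pathEdge H η (i + k) = pathEdge H ω (j + k) := by
  rw [pathEdge, pathEdge, (Boundary.drop_smul_tail h h' k).2, coset_mul_of_mem hg]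
  exact congrArg (fun τ : Boundary A => (_, τ.letter k)) h

variable [DecidableEq A]

theorem eventually_pathEdge_mem_smul {g : FreeGroup A} (hg : g ∈ H) {ω : Boundary A}
    (h : ∀ᶠ n in atTop, pathEdge H ω n ∈ T) :
    ∀ᶠ n in atTop, pathEdge H (g • ω) n ∈ T := by
  obtain ⟨i, j, h1, h2⟩ := ω.exists_drop_smul_eq g
  obtain ⟨N, hN⟩ := eventually_atTop.1 h
  refine eventually_atTop.2 ⟨i + N, fun n hn => ?_⟩
  obtain ⟨k, rfl⟩ := Nat.exists_eq_add_of_le ((Nat.le_add_right i N).trans hn)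
  rw [pathEdge_eq_of_drop_eq hg h1 h2]
  exact hN _ (by omega)

/-- Suitable prefixes of `ω` and `g • ω` differ by left multiplication by `g`. Both are tree
representatives of the same coset, so they are equal. -/
theorem eq_one_of_smul_mem_schreierDomain (hT : IsSpanningTree T) {g : FreeGroup A}
    (hg : g ∈ H) {ω : Boundary A} (hω : ω ∈ schreierDomain T) (hgω : g • ω ∈ schreierDomain T) :
    g = 1 := by
  rw [mem_schreierDomain_iff] at hω hgω
  obtain ⟨i, j, -, h2⟩ := ω.exists_drop_smul_eq g
  have h3 := mk_trunc_eq_treeElt hT fun k (_ : k < i) => hgω k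
  rw [h2, coset_mul_of_mem hg, ← mk_trunc_eq_treeElt hT fun k (_ : k < j) => hω k] at h3
  exact mul_eq_right.1 h3

/-- If the path stays in the tree from time `N` on, replace its first `N` letters by the tree word
of the vertex reached. The inverse of the loop element at time `N` does this. -/
theorem exists_smul_mem_schreierDomain (hT : IsSpanningTree T) {ω : Boundary A}
    (h : ∀ᶠ n in atTop, pathEdge H ω n ∈ T) : ∃ g ∈ H, g • ω ∈ schreierDomain T := by
  obtain ⟨N, hN⟩ := eventually_atTop.1 h
  have hg := H.inv_mem (loopElt_mem hT (ω.trunc N))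
  refine ⟨_, hg, ?_⟩
  have htree : ∀ n, treeElt hT (coset H (FreeGroup.mk (ω.trunc (N + n)))) =
      (loopElt hT (ω.trunc N))⁻¹ * FreeGroup.mk (ω.trunc (N + n)) := by
    intro n
    induction n with
    | zero => rw [add_zero, loopElt, mul_inv_rev, inv_inv, inv_mul_cancel_right]
    | succ n ih =>
      have h1 := treeElt_mul_letterElt hT
        (show ((pathEdge H ω (N + n)).1, (pathEdge H ω (N + n)).2) ∈ T from hN _ (by omega))
      rw [← add_assoc, ← step_pathEdge, ← h1, Boundary.trunc_succ, mk_append, ← mul_assoc, ← ih]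
      rfl
  obtain ⟨i, j, h1, h2⟩ := ω.exists_drop_smul_eq (loopElt hT (ω.trunc N))⁻¹
  -- The shift by `N` brings the matching prefix of `ω` to a length `j + N` ≥ `N`, where `htree`
  -- applies and the later edges are in the tree.
  obtain ⟨h1, h2⟩ := Boundary.drop_smul_tail h1 h2 N
  generalize (loopElt hT (ω.trunc N))⁻¹ • ω = η at h1 h2
  rw [mem_schreierDomain_iff]
  have hlt : ∀ k < i + N, pathEdge H η k ∈ T := by
    rw [← isPath_trunc_iff]
    have h3 : η.trunc (i + N) = treeWord hT (coset H (FreeGroup.mk (η.trunc (i + N)))) := by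
      rw [← toWord_treeElt, ← η.toWord_mk_trunc, FreeGroup.mk_toWord, h2, coset_mul_of_mem hg,
        add_comm j, htree]
    nth_rewrite 1 [h3]
    exact treeWord_isPath hT _
  intro n
  rcases lt_or_ge n (i + N) with hn | hn
  · exact hlt n hn
  · obtain ⟨k, rfl⟩ := Nat.exists_eq_add_of_le hn
    rw [pathEdge_eq_of_drop_eq hg h1 h2]
    exact hN _ (by omega)

theorem mem_iUnion_smul_schreierDomain_iff (hT : IsSpanningTree T) (ω : Boundary A) :
    ω ∈ ⋃ h : H, h • schreierDomain T ↔ ∀ᶠ n in atTop, pathEdge H ω n ∈ T := by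
  simp only [Set.mem_iUnion, Set.mem_smul_set_iff_inv_smul_mem]
  constructor
  · rintro ⟨h, hω⟩
    have := eventually_pathEdge_mem_smul (T := T) h.2
      (Eventually.of_forall ((mem_schreierDomain_iff _).1 hω))
    rwa [Subgroup.smul_def, Subgroup.coe_inv, smul_inv_smul] at this
  · intro h
    obtain ⟨g, hg, hω⟩ := exists_smul_mem_schreierDomain hT h
    exact ⟨⟨g, hg⟩⁻¹, by rwa [inv_inv]⟩

theorem pairwise_disjoint_smul_schreierDomain (hT : IsSpanningTree T) :
    Pairwise fun h h' : H => Disjoint (h • schreierDomain T) (h' • schreierDomain T) := by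
  intro h h' hne
  rw [Set.disjoint_left]
  intro ω h1 h2
  rw [Set.mem_smul_set_iff_inv_smul_mem] at h1 h2
  have h3 := eq_one_of_smul_mem_schreierDomain hT (g := ((h'⁻¹ * h : H) : FreeGroup A))
    (h'⁻¹ * h).2 h1 (by
      rw [← Subgroup.smul_def, mul_smul, smul_inv_smul]
      exact h2)
  exact hne (inv_mul_eq_one.1 (Subtype.ext h3)).symm

/-! ### The Schreier limit set -/

theorem exists_eq_of_mem_schreierGenerators (hT : IsSpanningTree T) {s : FreeGroup A}
    (hs : s ∈ schreierGenerators T) :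
    ∃ e : Edge H, e ∉ T ∧
      s = treeElt hT e.1 * letterElt e.2 * (treeElt hT (step e.1 e.2))⁻¹ := by
  obtain ⟨g, hg, a, g', hg', ha, hstep, rfl⟩ := hs
  refine ⟨(coset H g, a), ha, ?_⟩
  rw [hstep, ← eq_treeElt hT hg, ← eq_treeElt hT hg']

theorem mem_schreierGenerators (hT : IsSpanningTree T) {e : Edge H} (he : e ∉ T) :
    treeElt hT e.1 * letterElt e.2 * (treeElt hT (step e.1 e.2))⁻¹ ∈ schreierGenerators T := by
  refine ⟨_, treeElt_mem_transversal hT _, e.2, _, treeElt_mem_transversal hT _, ?_, ?_, rfl⟩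
  · rwa [coset_treeElt]
  · rw [coset_treeElt, coset_treeElt]

/-- The product telescopes: one more edge multiplies the loop element by a factor which is trivial
for a tree edge and is the Schreier generator for an off-tree edge. `Nat.count` numbers the off-tree
edges. -/
theorem prod_range_count (hT : IsSpanningTree T) (ω : Boundary A)
    [DecidablePred fun n => pathEdge H ω n ∉ T] {s : ℕ → FreeGroup A}
    (hs : ∀ n, pathEdge H ω n ∉ T → s (Nat.count (fun n => pathEdge H ω n ∉ T) n) =
      treeElt hT (pathEdge H ω n).1 * letterElt (pathEdge H ω n).2 *
        (treeElt hT (step (pathEdge H ω n).1 (pathEdge H ω n).2))⁻¹) (n : ℕ) :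
    ((List.range (Nat.count (fun n => pathEdge H ω n ∉ T) n)).map s).prod =
      loopElt hT (ω.trunc n) := by
  induction n with
  | zero =>
    have h : treeElt hT (coset H 1) = 1 := by
      rw [treeElt, ← eq_treeWord hT (w := []) .nil rfl]
      rfl
    simp [loopElt, Boundary.trunc_zero, ← FreeGroup.one_eq_mk, h]
  | succ n ih =>
    have h1 : loopElt hT (ω.trunc (n + 1)) = loopElt hT (ω.trunc n) *
        (treeElt hT (pathEdge H ω n).1 * letterElt (pathEdge H ω n).2 *
          (treeElt hT (step (pathEdge H ω n).1 (pathEdge H ω n).2))⁻¹) := by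
      rw [step_pathEdge, loopElt, loopElt, ω.trunc_succ, mk_append]
      simp only [pathEdge, mul_assoc, inv_mul_cancel_left]
      rfl
    rw [h1, Nat.count_succ]
    by_cases h : pathEdge H ω n ∉ T
    · rw [if_pos h, List.range_succ, List.map_append, List.prod_append, ih]
      simp [hs n h]
    · have h2 : ((pathEdge H ω n).1, (pathEdge H ω n).2) ∈ T := not_not.1 h
      rw [if_neg h, add_zero, ih, treeElt_mul_letterElt hT h2, mul_inv_cancel, mul_one]

/-- Take for `s` the generators of the successive off-tree edges of `ω`. Their partial products are
loop elements, whose reduced words begin with longer and longer prefixes of `ω`. -/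
theorem mem_schreierLimitSet (hT : IsSpanningTree T) {ω : Boundary A}
    (h : ∃ᶠ n in atTop, pathEdge H ω n ∉ T) : ω ∈ schreierLimitSet T := by
  classical
  set p : ℕ → Prop := fun n => pathEdge H ω n ∉ T with hp
  have hinf : (Set.ofPred p).Infinite := Nat.frequently_atTop_iff_infinite.1 h
  have hnth : ∀ n, p (Nat.nth p n) := Nat.nth_mem_of_infinite hinf
  let s : ℕ → FreeGroup A := fun n =>
    treeElt hT (pathEdge H ω (Nat.nth p n)).1 * letterElt (pathEdge H ω (Nat.nth p n)).2 *
      (treeElt hT (step (pathEdge H ω (Nat.nth p n)).1 (pathEdge H ω (Nat.nth p n)).2))⁻¹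
  have hprod : ∀ k, ((List.range (k + 1)).map s).prod =
      loopElt hT (ω.trunc (Nat.nth p k + 1)) := by
    intro k
    rw [← prod_range_count hT ω (s := s), Nat.count_succ, if_pos (hnth k),
      Nat.count_nth_of_infinite hinf]
    intro n hn
    simp only [s]
    rw [Nat.nth_count hn]
  have hoff : ∀ k, EndsOff T (ω.trunc (Nat.nth p k + 1)) := fun k => endsOff_trunc_succ (hnth k)
  refine ⟨s, fun n => mem_schreierGenerators hT (hnth n), fun n hn => ?_, fun k => ?_⟩
  · have h2 : ((List.range (n + 2)).map s).prod = ((List.range n).map s).prod := by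
      simp [List.range_succ, hn]
    rw [hprod] at h2
    cases n with
    | zero =>
      have h3 := toWord_loopElt hT (ω.trunc_isReduced _) (hoff 1)
      rw [h2] at h3
      simp [Boundary.trunc_succ] at h3
    | succ n =>
      rw [hprod] at h2
      have h3 := loopElt_inj hT (ω.trunc_isReduced _) (hoff _) (ω.trunc_isReduced _) (hoff _) h2
      have h4 := congrArg List.length h3
      rw [ω.length_trunc, ω.length_trunc] at h4
      have : Nat.nth p n < Nat.nth p (n + 1 + 1) := Nat.nth_strictMono hinf (by omega)
      omega
  · refine eventually_atTop.2 ⟨k + 1, fun n hn => ?_⟩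
    obtain ⟨n, rfl⟩ := Nat.exists_eq_add_of_le' (Nat.one_le_of_lt hn)
    have hk : k ≤ Nat.nth p n + 1 := by
      have := (Nat.nth_strictMono hinf).le_apply (x := n)
      omega
    change (((List.range (n + 1)).map s).prod).toWord.take k = ω.trunc k
    rw [hprod, toWord_loopElt hT (ω.trunc_isReduced _) (hoff n),
      List.take_append_of_le_length (by rwa [ω.length_trunc]), ω.take_trunc hk]

/-- The generators are spelled into nested reduced words, each ending with the off-tree edge of the
last generator used. The limit begins with all of them, so its path crosses all these edges. -/
theorem frequently_of_mem_schreierLimitSet (hT : IsSpanningTree T) {ω : Boundary A}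
    (h : ω ∈ schreierLimitSet T) : ∃ᶠ n in atTop, pathEdge H ω n ∉ T := by
  obtain ⟨s, hs, hne, hlim⟩ := h
  choose e he hse using fun n => exists_eq_of_mem_schreierGenerators hT (hs n)
  have hrev : ∀ n, e (n + 1) ≠ Edge.reverse (e n) := by
    intro n hn
    apply hne n
    rw [hse, hse, hn, Edge.reverse, step_step_inv, letterElt_letterInv]
    group
  -- `v` is the reduced word of a path from the root to the start of the edge `e n`; crossing that
  -- edge and returning along the tree gives the product of the first `n + 1` generators.
  let P : ℕ → List (Letter A) → Prop := fun n v =>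
    FreeGroup.IsReduced (v ++ [(e n).2]) ∧ coset H (FreeGroup.mk v) = (e n).1 ∧
      ((List.range (n + 1)).map s).prod = loopElt hT (v ++ [(e n).2])
  have hloop : ∀ n v g, FreeGroup.mk v = g * treeElt hT (e n).1 →
      coset H (FreeGroup.mk v) = (e n).1 → loopElt hT (v ++ [(e n).2]) = g * s n := by
    intro n v g hv hc
    have h1 : step (e n).1 (e n).2 = coset H (FreeGroup.mk (v ++ [(e n).2])) := by
      rw [← hc, mk_append]
      rfl
    rw [hse, h1, loopElt, mk_append, hv]
    simp only [mul_assoc]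
    rfl
  have h0 : P 0 (treeWord hT (e 0).1) := by
    have hc : coset H (FreeGroup.mk (treeWord hT (e 0).1)) = (e 0).1 := coset_treeElt hT _
    refine ⟨?_, hc, ?_⟩
    · by_cases hnil : treeWord hT (e 0).1 = []
      · rw [hnil]
        exact .singleton
      · exact isReduced_concat_of_notMem hT (u := []) (treeWord_isReduced hT _) hnil
          (treeWord_isPath hT _) (he 0)
    · rw [hloop 0 _ 1 (one_mul _).symm hc]
      simp
  have hstep : ∀ n v, P n v → ∃ p, P (n + 1) (v ++ [(e n).2] ++ p) := by
    rintro n v ⟨h1, h2, h3⟩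
    have ho : (coset H (FreeGroup.mk v), (e n).2) ∉ T := by
      rw [h2]
      exact he n
    obtain ⟨p, hp, hmk⟩ := EndsOff.exists_extension hT h1 ho (he (n + 1))
      (by rw [h2]; exact hrev n)
    have hc : coset H (FreeGroup.mk (v ++ [(e n).2] ++ p)) = (e (n + 1)).1 := by
      rw [hmk, coset_mul_of_mem (loopElt_mem hT _), coset_treeElt]
    refine ⟨p, hp, hc, ?_⟩
    rw [hloop (n + 1) _ _ hmk hc, List.range_succ, List.map_append, List.prod_append, h3]
    simp
  choose! p hp using hstep
  let V : ℕ → List (Letter A) := fun n =>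
    Nat.rec (treeWord hT (e 0).1) (fun n v => v ++ [(e n).2] ++ p n v) n
  have hV : ∀ n, P n (V n) := fun n => by
    induction n with
    | zero => exact h0
    | succ n ih => exact hp n _ ih
  have hlen : ∀ n, n ≤ (V n).length := fun n => by
    induction n with
    | zero => exact Nat.zero_le _
    | succ n ih =>
      change n + 1 ≤ (V n ++ [(e n).2] ++ p n (V n)).length
      simp only [List.length_append, List.length_singleton]
      omega
  have hpre : ∀ n m, V n ++ [(e n).2] <+: V (n + m) ++ [(e (n + m)).2] := fun n m => by
    induction m with
    | zero => exact List.prefix_rfl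
    | succ m ih =>
      refine ih.trans ?_
      change _ <+: V (n + m) ++ [(e (n + m)).2] ++ p (n + m) (V (n + m)) ++ _
      rw [List.append_assoc _ (p _ _)]
      exact List.prefix_append _ _
  refine frequently_atTop.2 fun n => ⟨(V n).length, hlen n, ?_⟩
  have hbegin : ω.BeginsWith (V n ++ [(e n).2]) := by
    obtain ⟨N, hN⟩ := eventually_atTop.1 (hlim (V n ++ [(e n).2]).length)
    -- The index is past the convergence threshold `N`, and the corresponding word `V (n + N)`
    -- followed by its edge extends `V n` followed by its own.
    have h1 := hN (n + N + 1) (by omega)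
    obtain ⟨hred, hc, hprod⟩ := hV (n + N)
    change (((List.range (n + N + 1)).map s).prod).toWord.take _ = _ at h1
    rw [hprod, toWord_loopElt hT hred ⟨_, _, rfl, by rw [hc]; exact he _⟩] at h1
    rw [Boundary.BeginsWith, ← h1]
    exact (List.prefix_iff_eq_take.1 ((hpre n N).trans (List.prefix_append _ _))).symm
  rw [pathEdge_of_beginsWith hbegin, (hV n).2.1]
  exact he n

theorem mem_schreierLimitSet_iff (hT : IsSpanningTree T) (ω : Boundary A) :
    ω ∈ schreierLimitSet T ↔ ∃ᶠ n in atTop, pathEdge H ω n ∉ T :=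
  ⟨frequently_of_mem_schreierLimitSet hT, mem_schreierLimitSet hT⟩

theorem schreierLimitSet_eq_compl (hT : IsSpanningTree T) :
    schreierLimitSet T = (⋃ h : H, h • schreierDomain T)ᶜ := by
  ext ω
  rw [Set.mem_compl_iff, mem_iUnion_smul_schreierDomain_iff hT, mem_schreierLimitSet_iff hT,
    not_eventually]

end Crossings

/-! ### Measurability of the boundary action -/

namespace Boundary

variable {A : Type*} [DecidableEq A]

theorem measurableSet_cylinder (g : FreeGroup A) : MeasurableSet (cylinder g) :=
  MeasurableSpace.measurableSet_generateFrom ⟨g, rfl⟩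

variable [Countable A]

theorem measurableSet_trunc (n : ℕ) (P : List (Letter A) → Prop) :
    MeasurableSet {ω : Boundary A | P (ω.trunc n)} := by
  have h : {ω : Boundary A | P (ω.trunc n)} =
      ⋃ w ∈ {w : List (Letter A) | P w ∧ w.length = n ∧ FreeGroup.IsReduced w},
        cylinder (FreeGroup.mk w) := by
    ext ω
    simp only [Set.mem_ofPred_eq, Set.mem_iUnion, exists_prop, cylinder, BeginsWith]
    constructor
    · intro hω
      refine ⟨ω.trunc n, ⟨hω, ω.length_trunc n, ω.trunc_isReduced n⟩, ?_⟩
      rw [toWord_mk_trunc, length_trunc]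
    · rintro ⟨w, ⟨hP, rfl, hr⟩, hω⟩
      rw [FreeGroup.toWord_mk, hr.reduce_eq] at hω
      rwa [hω]
  rw [h]
  exact MeasurableSet.biUnion (Set.to_countable _) fun w _ => measurableSet_cylinder _

theorem measurableSet_letter_eq (n : ℕ) (a : Letter A) :
    MeasurableSet {ω : Boundary A | ω.letter n = a} := by
  convert measurableSet_trunc n.succ (fun w => w[n]? = some a) using 3 with ω
  simp [trunc]

omit [Countable A] in
theorem measurable_of_letter {X : Type*} [MeasurableSpace X] {f : X → Boundary A}
    (h : ∀ n a, MeasurableSet {x | (f x).letter n = a}) : Measurable f := by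
  refine measurable_generateFrom ?_
  rintro _ ⟨g, rfl⟩
  have h1 : f ⁻¹' cylinder g =
      ⋂ (i : ℕ) (hi : i < g.toWord.length), {x | (f x).letter i = g.toWord[i]} := by
    ext x
    simp [cylinder, beginsWith_iff]
  rw [h1]
  exact MeasurableSet.iInter fun i => MeasurableSet.iInter fun hi => h _ _

theorem measurable_mulLetter (a : Letter A) : Measurable (mulLetter a) := by
  refine measurable_of_letter fun n b => ?_
  have h1 : {ω : Boundary A | (mulLetter a ω).letter n = b} =
      {ω | ω.letter 0 = letterInv a} ∩ {ω | ω.letter (n + 1) = b} ∪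
        {ω | ω.letter 0 = letterInv a}ᶜ ∩
          {ω | (Nat.casesOn n a ω.letter : Letter A) = b} := by
    ext ω
    by_cases h : ω.letter 0 = letterInv a <;> simp [mulLetter, h, tail, cons]
  rw [h1]
  refine ((measurableSet_letter_eq _ _).inter (measurableSet_letter_eq _ _)).union
    ((measurableSet_letter_eq _ _).compl.inter ?_)
  cases n with
  | zero => exact MeasurableSet.const (a = b)
  | succ n => exact measurableSet_letter_eq n b

instance instMeasurableConstSMul : MeasurableConstSMul (FreeGroup A) (Boundary A) where
  measurable_const_smul g := by
    obtain ⟨w, rfl⟩ : ∃ w, FreeGroup.mk w = g := ⟨_, FreeGroup.mk_toWord⟩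
    induction w with
    | nil => simpa only [← FreeGroup.one_eq_mk, one_smul] using measurable_id'
    | cons a w ih =>
      have h : (fun ω : Boundary A => FreeGroup.mk (a :: w) • ω) =
          mulLetter a ∘ fun ω => FreeGroup.mk w • ω := by
        funext ω
        rw [Function.comp_apply, ← letterElt_smul, ← mul_smul, ← List.singleton_append, mk_append]
        rfl
      exact h ▸ (measurable_mulLetter a).comp ih

end Boundary

/-! ### Behaviour of the uniform measure under the action -/

section Uniform

open Boundary

variable {A : Type*} [DecidableEq A]

theorem letterElt_smul_cylinder_inter (a : Letter A) (g : FreeGroup A) :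
    letterElt a • (Boundary.cylinder g ∩ {ω : Boundary A | ω.letter 0 ≠ letterInv a}) =
      {ω | ω.BeginsWith (a :: g.toWord)} ∩ {ω | ω.tail.letter 0 ≠ letterInv a} := by
  ext ω
  rw [Set.mem_smul_set_iff_inv_smul_mem, ← letterElt_letterInv, letterElt_smul]
  by_cases h : ω.letter 0 = a
  · have h1 : mulLetter (letterInv a) ω = ω.tail := by
      rw [mulLetter, dif_pos (by rw [letterInv_letterInv, h])]
    rw [h1]
    simp only [Boundary.cylinder, Set.mem_inter_iff, Set.mem_ofPred_eq, beginsWith_iff]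
    refine and_congr_left fun _ => ⟨fun h2 i hi => ?_, fun h2 i hi => ?_⟩
    · cases i with
      | zero => exact h
      | succ i => exact h2 i (by simpa using hi)
    · exact h2 (i + 1) (by simpa using hi)
  · have h1 : ω.letter 0 ≠ letterInv (letterInv a) := by rwa [letterInv_letterInv]
    rw [mulLetter, dif_neg h1]
    refine iff_of_false (fun h2 => h2.2 rfl) (fun h2 => h ?_)
    exact (beginsWith_iff _ _).1 h2.1 0 (by simp)

variable [Fintype A]

/-- The ratio `2m - 1` of the measures of successive cylinders. -/
noncomputable def branching (A : Type*) [Fintype A] : ℝ≥0∞ := 2 * (Fintype.card A : ℝ≥0∞) - 1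

omit [DecidableEq A] in
theorem branching_ne_top : branching A ≠ ∞ :=
  ENNReal.sub_ne_top (ENNReal.mul_ne_top (by simp) (by simp))

omit [DecidableEq A] in
theorem one_le_branching [Nonempty A] : 1 ≤ branching A := by
  have h : (1 : ℝ≥0∞) ≤ Fintype.card A := by exact_mod_cast Fintype.card_pos (α := A)
  refine ENNReal.le_sub_of_add_le_left (by simp) ?_
  calc (1 : ℝ≥0∞) + 1 = 2 * 1 := by norm_num
    _ ≤ _ := by gcongr

omit [DecidableEq A] in
theorem inv_branching_ne_zero : (branching A)⁻¹ ≠ 0 :=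
  ENNReal.inv_ne_zero.2 branching_ne_top

omit [DecidableEq A] in
theorem inv_branching_le_one [Nonempty A] : (branching A)⁻¹ ≤ 1 :=
  ENNReal.inv_le_one.2 one_le_branching

variable [Nonempty A] {μ : Measure (Boundary A)}

theorem IsUniform.measure_cylinder_mk (hμ : IsUniform μ) {w : List (Letter A)} {a : Letter A}
    (h : FreeGroup.IsReduced (a :: w)) :
    μ {ω | ω.BeginsWith (a :: w)} =
      (2 * (Fintype.card A : ℝ≥0∞))⁻¹ * (branching A)⁻¹ ^ w.length := by
  have h1 : (FreeGroup.mk (a :: w)).toWord = a :: w := by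
    rw [FreeGroup.toWord_mk, h.reduce_eq]
  have h2 : FreeGroup.mk (a :: w) ≠ 1 := by
    rw [Ne, ← FreeGroup.toWord_eq_nil_iff, h1]
    simp
  have h3 := hμ.measure_cylinder _ h2
  rw [Boundary.cylinder, FreeGroup.norm, h1] at h3
  rw [h3, List.length_cons, Nat.add_sub_cancel, ENNReal.mul_inv, ENNReal.inv_pow]
  · rfl
  · exact Or.inl (by simp)
  · exact Or.inl (ENNReal.mul_ne_top (by simp) (by simp))

theorem IsUniform.measure_letter_ne (hμ : IsUniform μ) (a : Letter A) :
    μ {ω | ω.letter 0 ≠ a} = branching A * (2 * (Fintype.card A : ℝ≥0∞))⁻¹ := by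
  have := hμ.isProbabilityMeasure
  have h1 : {ω : Boundary A | ω.letter 0 = a} = {ω | ω.BeginsWith [a]} := by
    ext ω
    simp [beginsWith_iff]
  have h2 := hμ.measure_cylinder_mk (w := []) (a := a) .singleton
  have h0 : (2 * (Fintype.card A : ℝ≥0∞)) ≠ 0 := by simp
  have ht : (2 * (Fintype.card A : ℝ≥0∞)) ≠ ∞ := ENNReal.mul_ne_top (by simp) (by simp)
  change μ {ω | ω.letter 0 = a}ᶜ = _
  rw [prob_compl_eq_one_sub (measurableSet_letter_eq 0 a), h1, h2, branching,
    ENNReal.sub_mul (by simp [h0]), ENNReal.mul_inv_cancel h0 ht]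
  simp

/-- On words not beginning with the inverse of `a` the action of `a` is prepending, which lengthens
a nonempty prefix by one and divides the measure of its cylinder by 2m − 1. Cylinders form a
π-system, so this extends to all measurable sets. -/
theorem IsUniform.measure_letterElt_smul_inter (hμ : IsUniform μ) (a : Letter A)
    {E : Set (Boundary A)} (hE : MeasurableSet E) :
    μ (letterElt a • (E ∩ {ω | ω.letter 0 ≠ letterInv a})) =
      (branching A)⁻¹ * μ (E ∩ {ω | ω.letter 0 ≠ letterInv a}) := by
  have := hμ.isProbabilityMeasure
  have hS : MeasurableSet {ω : Boundary A | ω.letter 0 ≠ letterInv a} :=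
    (measurableSet_letter_eq 0 _).compl
  have hm : Measurable fun ω : Boundary A => (letterElt a)⁻¹ • ω := measurable_const_smul _
  have key : ∀ g : FreeGroup A,
      μ (letterElt a • (Boundary.cylinder g ∩ {ω | ω.letter 0 ≠ letterInv a})) =
        (branching A)⁻¹ * μ (Boundary.cylinder g ∩ {ω | ω.letter 0 ≠ letterInv a}) := by
    intro g
    rw [letterElt_smul_cylinder_inter]
    have hb : (branching A)⁻¹ * branching A = 1 :=
      ENNReal.inv_mul_cancel (one_pos.trans_le one_le_branching).ne' branching_ne_top
    have hred := g.isReduced_toWord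
    have htail : {ω : Boundary A | ω.BeginsWith (a :: g.toWord)} ⊆
        {ω | ω.tail.letter 0 ≠ letterInv a} := by
      intro ω hω
      have h0 : ω.letter 0 = a := (beginsWith_iff _ _).1 hω 0 (by simp)
      exact h0 ▸ ω.reduced 0
    rw [Set.inter_eq_left.2 htail]
    rw [Boundary.cylinder]
    cases hw : g.toWord with
    -- The full space does not follow the cylinder formula: here the ratio comes from comparing one
    -- first letter with the 2m − 1 letters other than the inverse of `a`.
    | nil =>
      have h1 : {ω : Boundary A | ω.BeginsWith []} = Set.univ := by
        ext ω
        simp [beginsWith_iff]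
      rw [h1, Set.univ_inter, hμ.measure_letter_ne, hμ.measure_cylinder_mk .singleton, ← mul_assoc,
        hb, one_mul]
      simp
    | cons b w =>
      rw [hw] at hred htail
      by_cases hab : b = letterInv a
      · have h1 : {ω : Boundary A | ω.BeginsWith (a :: b :: w)} = ∅ := by
          refine Set.eq_empty_of_forall_notMem fun ω hω => htail hω ?_
          rw [← hab]
          exact (beginsWith_iff _ _).1 hω 1 (by simp)
        have h2 : {ω : Boundary A | ω.BeginsWith (b :: w)} ∩
            {ω | ω.letter 0 ≠ letterInv a} = ∅ := by
          refine Set.eq_empty_of_forall_notMem fun ω hω => hω.2 ?_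
          rw [← hab]
          exact (beginsWith_iff _ _).1 hω.1 0 (by simp)
        rw [h1, h2]
        simp
      · have h2 : {ω : Boundary A | ω.BeginsWith (b :: w)} ⊆
            {ω | ω.letter 0 ≠ letterInv a} := by
          intro ω hω
          have h0 : ω.letter 0 = b := (beginsWith_iff _ _).1 hω 0 (by simp)
          exact fun h => hab (h0 ▸ h)
        rw [Set.inter_eq_left.2 h2, hμ.measure_cylinder_mk hred,
          hμ.measure_cylinder_mk (FreeGroup.isReduced_cons_cons.2 ⟨(reduced_rel_iff a b).2 hab, hred⟩),
          List.length_cons, pow_succ]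
        ring
  have hext : (μ.map fun ω => (letterElt a)⁻¹ • ω).restrict {ω | ω.letter 0 ≠ letterInv a} =
      (branching A)⁻¹ • μ.restrict {ω | ω.letter 0 ≠ letterInv a} := by
    have := Measure.isProbabilityMeasure_map (μ := μ) hm.aemeasurable
    have hcyl : ∀ g : FreeGroup A,
        (μ.map fun ω => (letterElt a)⁻¹ • ω).restrict {ω | ω.letter 0 ≠ letterInv a} (Boundary.cylinder g) =
          ((branching A)⁻¹ • μ.restrict {ω | ω.letter 0 ≠ letterInv a}) (Boundary.cylinder g) := by
      intro g
      have hg := measurableSet_cylinder g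
      rw [Measure.restrict_apply hg, Measure.map_apply hm (hg.inter hS), Set.preimage_smul_inv,
        key, Measure.smul_apply, Measure.restrict_apply hg, smul_eq_mul]
    refine ext_of_generate_finite _ rfl isPiSystem_cylinder ?_ ?_
    · rintro _ ⟨g, rfl⟩
      exact hcyl g
    · rw [← cylinder_one]
      exact hcyl 1
  have h := congrArg (fun ν => ν E) hext
  simp only [Measure.smul_apply, smul_eq_mul] at h
  rwa [Measure.restrict_apply hE, Measure.map_apply hm (hE.inter hS), Set.preimage_smul_inv,
    Measure.restrict_apply hE] at h

/-- Prepending divides the measure by 2m − 1 and cancelling multiplies it by 2m − 1 ≥ 1, so a letter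
costs at most one factor 2m − 1. -/
theorem IsUniform.le_measure_letterElt_smul (hμ : IsUniform μ) (a : Letter A)
    {E : Set (Boundary A)} (hE : MeasurableSet E) :
    (branching A)⁻¹ * μ E ≤ μ (letterElt a • E) := by
  have hS : MeasurableSet {ω : Boundary A | ω.letter 0 ≠ letterInv a} :=
    (measurableSet_letter_eq 0 _).compl
  rw [← measure_inter_add_sdiff E hS, ← measure_inter_add_sdiff (letterElt a • E)
    (hS.const_smul (letterElt a)), ← Set.smul_set_inter, ← Set.smul_set_sdiff, mul_add,
    hμ.measure_letterElt_smul_inter a hE]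
  gcongr
  set D := E \ {ω | ω.letter 0 ≠ letterInv a} with hD
  have h1 : letterElt a • D ∩ {ω | ω.letter 0 ≠ letterInv (letterInv a)} = letterElt a • D := by
    refine Set.inter_eq_left.2 ?_
    rintro _ ⟨ω, hω, rfl⟩
    have h0 : ω.letter 0 = letterInv a := not_not.1 hω.2
    change (letterElt a • ω).letter 0 ≠ _
    rw [letterElt_smul, mulLetter, dif_pos h0, ← h0]
    exact ω.reduced 0
  -- On `D` the letter `a` cancels; the inverse letter prepends on the image and recovers `D`.
  have h2 := hμ.measure_letterElt_smul_inter (letterInv a)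
    ((hE.diff hS).const_smul (letterElt a))
  rw [h1, letterElt_letterInv, inv_smul_smul] at h2
  calc (branching A)⁻¹ * μ D ≤ 1 * μ D := by gcongr; exact inv_branching_le_one
    _ = (branching A)⁻¹ * μ (letterElt a • D) := by rw [one_mul, h2]
    _ ≤ 1 * μ (letterElt a • D) := by gcongr; exact inv_branching_le_one
    _ = _ := one_mul _

theorem IsUniform.le_measure_mk_smul (hμ : IsUniform μ) (v : List (Letter A))
    {E : Set (Boundary A)} (hE : MeasurableSet E) :
    (branching A)⁻¹ ^ v.length * μ E ≤ μ (FreeGroup.mk v • E) := by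
  induction v with
  | nil => simp [← FreeGroup.one_eq_mk]
  | cons a v ih =>
    rw [← List.singleton_append, mk_append, mul_smul]
    calc _ = (branching A)⁻¹ * ((branching A)⁻¹ ^ v.length * μ E) := by
          simp only [List.singleton_append, List.length_cons]
          ring
      _ ≤ (branching A)⁻¹ * μ (FreeGroup.mk v • E) := by gcongr
      _ ≤ _ := hμ.le_measure_letterElt_smul a (hE.const_smul _)

/-- The lower bound for `g⁻¹`, applied to the translate of a measurable null hull, bounds a positive
multiple of its measure by zero. -/
theorem IsUniform.measure_smul_null (hμ : IsUniform μ) (g : FreeGroup A) {E : Set (Boundary A)}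
    (hE : μ E = 0) : μ (g • E) = 0 := by
  refine measure_mono_null (Set.smul_set_mono (subset_toMeasurable μ E)) ?_
  have h := hμ.le_measure_mk_smul (g⁻¹).toWord
    ((measurableSet_toMeasurable μ E).const_smul g)
  rw [FreeGroup.mk_toWord, inv_smul_smul, measure_toMeasurable, hE, nonpos_iff_eq_zero,
    mul_eq_zero] at h
  exact h.resolve_left (pow_ne_zero _ inv_branching_ne_zero)

/-- On words beginning with `u` the inverse of `u` strips its letters one at a time, and each
removal scales the measure exactly. -/
theorem IsUniform.measure_eq_of_beginsWith (hμ : IsUniform μ) (u : List (Letter A))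
    {E : Set (Boundary A)} (hE : MeasurableSet E) (hu : ∀ ω ∈ E, ω.BeginsWith u) :
    μ E = (branching A)⁻¹ ^ u.length * μ ((FreeGroup.mk u)⁻¹ • E) := by
  induction u generalizing E with
  | nil => simp [← FreeGroup.one_eq_mk]
  | cons a u ih =>
    have hsmul : ∀ ω ∈ E, (letterElt a)⁻¹ • ω = ω.tail := by
      intro ω hω
      have h0 : ω.letter 0 = a := (beginsWith_iff _ _).1 (hu ω hω) 0 (by simp)
      rw [← letterElt_letterInv, letterElt_smul, mulLetter,
        dif_pos (by rw [letterInv_letterInv, h0])]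
    have h1 : (letterElt a)⁻¹ • E ∩ {ω | ω.letter 0 ≠ letterInv a} = (letterElt a)⁻¹ • E := by
      refine Set.inter_eq_left.2 ?_
      rintro _ ⟨ω, hω, rfl⟩
      have h0 : ω.letter 0 = a := (beginsWith_iff _ _).1 (hu ω hω) 0 (by simp)
      change ((letterElt a)⁻¹ • ω).letter 0 ≠ _
      rw [hsmul ω hω, ← h0]
      exact ω.reduced 0
    have h2 := hμ.measure_letterElt_smul_inter a (hE.const_smul (letterElt a)⁻¹)
    rw [h1, smul_inv_smul] at h2
    rw [h2, ih (hE.const_smul _), List.length_cons, ← List.singleton_append, mk_append,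
      mul_inv_rev, mul_smul, pow_succ']
    · rw [mul_assoc]
      rfl
    · rintro _ ⟨ω, hω, rfl⟩
      change ((letterElt a)⁻¹ • ω).BeginsWith u
      rw [hsmul ω hω]
      have h3 := (beginsWith_iff _ _).1 (hu ω hω)
      exact (beginsWith_iff _ _).2 fun i hi => h3 (i + 1) (by simpa using hi)

/-- Replacing a prefix of an infinite word by a word which is not longer does not decrease the
uniform measure. -/
theorem IsUniform.measure_le_of_beginsWith (hμ : IsUniform μ) {u v : List (Letter A)}
    (huv : v.length ≤ u.length) {E : Set (Boundary A)} (hE : MeasurableSet E)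
    (hu : ∀ ω ∈ E, ω.BeginsWith u) :
    μ E ≤ μ ((FreeGroup.mk v * (FreeGroup.mk u)⁻¹) • E) := by
  rw [mul_smul]
  calc μ E = (branching A)⁻¹ ^ u.length * μ ((FreeGroup.mk u)⁻¹ • E) :=
        hμ.measure_eq_of_beginsWith u hE hu
    _ ≤ (branching A)⁻¹ ^ v.length * μ ((FreeGroup.mk u)⁻¹ • E) := by
        gcongr ?_ * _
        exact pow_le_pow_right_of_le_one' inv_branching_le_one huv
    _ ≤ _ := hμ.le_measure_mk_smul v (hE.const_smul _)

end Uniform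

/-! ### The Hopf decomposition -/

section HopfDecomposition

variable {A : Type*} [DecidableEq A] {H : Subgroup (FreeGroup A)} {T : Set (Edge H)}

theorem measurableSet_pathEdge_mem [Countable A] (T : Set (Edge H)) (n : ℕ) :
    MeasurableSet {ω : Boundary A | pathEdge H ω n ∈ T} := by
  convert Boundary.measurableSet_trunc n.succ
    (fun w => ∃ v a, w = v ++ [a] ∧ (coset H (FreeGroup.mk v), a) ∈ T) using 3 with ω
  constructor
  · exact fun h => ⟨_, _, ω.trunc_succ n, h⟩
  · rintro ⟨v, a, h, hT⟩
    rw [Nat.succ_eq_add_one, ω.trunc_succ] at h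
    obtain ⟨h1, h2⟩ := List.append_inj' h rfl
    obtain h2 : ω.letter n = a := by simpa using h2
    rwa [pathEdge, h1, h2]

theorem measurableSet_schreierDomain [Countable A] (T : Set (Edge H)) :
    MeasurableSet (schreierDomain T) := by
  have h : schreierDomain T = ⋂ n, {ω : Boundary A | pathEdge H ω n ∈ T} := by
    ext ω
    simp [mem_schreierDomain_iff]
  rw [h]
  exact MeasurableSet.iInter (measurableSet_pathEdge_mem T)

theorem countable_freeGroup [Countable A] : Countable (FreeGroup A) :=
  FreeGroup.toWord_injective.countable

theorem measurableSet_iUnion_smul_schreierDomain [Countable A] (T : Set (Edge H)) :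
    MeasurableSet (⋃ h : H, h • schreierDomain T) := by
  have := countable_freeGroup (A := A)
  exact MeasurableSet.iUnion fun h => (measurableSet_schreierDomain T).const_smul h

theorem smul_iUnion_smul {G X : Type*} [Group G] [MulAction G X] (g : G) (S : Set X) :
    g • (⋃ h : G, h • S) = ⋃ h : G, h • S := by
  simp only [Set.smul_set_iUnion, smul_smul]
  exact (Equiv.mulLeft g).iSup_comp (g := fun h => h • S)

/-! ### Conservativity on the limit set and uniqueness of the decomposition. -/

variable [Fintype A] [Nonempty A] {μ : Measure (Boundary A)}

/-- A measurable subset of the limit set which is disjoint from its non-trivial translates is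
negligible. -/
theorem IsUniform.measure_eq_zero_of_wandering (hμ : IsUniform μ) (hT : IsGeodesicSpanningTree T)
    {W : Set (Boundary A)} (hW : MeasurableSet W) (hlim : W ⊆ schreierLimitSet T)
    (hwand : ∀ x ∈ W, ∀ g ∈ H, g • x ∈ W → g = 1) : μ W = 0 := by
  have := hμ.isProbabilityMeasure
  have hS := hT.toIsSpanningTree
  let ι := {u : List (Letter A) // FreeGroup.IsReduced u ∧ EndsOff T u}
  let s : ι → Set (Boundary A) := fun u => W ∩ {ω | ω.BeginsWith u.1}
  have hs : ∀ u, MeasurableSet (s u) := fun u =>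
    hW.inter (Boundary.measurableSet_trunc u.1.length fun w => w = u.1)
  -- The inverse loop element replaces the prefix `u` by the tree word of the same vertex, which is
  -- not longer.
  have hle : ∀ u, μ (s u) ≤ μ ((loopElt hS u.1)⁻¹ • s u) := by
    intro u
    have h := hμ.measure_le_of_beginsWith (length_treeWord_le hT u.1) (hs u) fun ω hω => hω.2
    rwa [loopElt, mul_inv_rev, inv_inv]
  -- A common point of two images gives an element of `H` carrying a point of `W` into `W`. It is
  -- trivial, so the loop elements agree and so do the words.
  have hdisj : Pairwise (Function.onFun Disjoint fun u : ι => (loopElt hS u.1)⁻¹ • s u) := by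
    intro u v huv
    refine Set.disjoint_left.2 fun x hu hv => huv ?_
    rw [Set.mem_smul_set_iff_inv_smul_mem, inv_inv] at hu hv
    have h1 := hwand _ hu.1 (loopElt hS v.1 * (loopElt hS u.1)⁻¹)
      (H.mul_mem (loopElt_mem hS _) (H.inv_mem (loopElt_mem hS _))) (by
        rw [mul_smul, inv_smul_smul]
        exact hv.1)
    exact Subtype.ext (loopElt_inj hS u.2.1 u.2.2 v.2.1 v.2.2 (mul_inv_eq_one.1 h1).symm)
  have hsum : ∑' u, μ (s u) ≠ ∞ := by
    refine ne_top_of_le_ne_top (measure_ne_top μ Set.univ) ?_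
    calc ∑' u, μ (s u) ≤ ∑' u, μ ((loopElt hS u.1)⁻¹ • s u) := ENNReal.tsum_le_tsum hle
      _ = μ (⋃ u, (loopElt hS u.1)⁻¹ • s u) :=
        (measure_iUnion hdisj fun u => (hs u).const_smul _).symm
      _ ≤ μ Set.univ := measure_mono (Set.subset_univ _)
  rw [measure_eq_zero_iff_ae_notMem]
  -- Borel–Cantelli: almost every point lies in finitely many of the sets `s u`. A crossing at a
  -- time at least the largest length `N` of these words gives one more of them, of length greater
  -- than `N`.
  filter_upwards [ae_finite_setOfPred_mem hsum] with ω hfin hω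
  obtain ⟨N, hN⟩ := (hfin.image fun u : ι => u.1.length).bddAbove
  obtain ⟨n, hn, hoff⟩ := frequently_atTop.1 ((mem_schreierLimitSet_iff hS ω).1 (hlim hω)) N
  have h1 : (ω.trunc (n + 1)).length ≤ N := hN
    ⟨⟨ω.trunc (n + 1), ω.trunc_isReduced _, endsOff_trunc_succ hoff⟩, ⟨hω, by
      change ω.trunc _ = _
      rw [ω.length_trunc]⟩, rfl⟩
  rw [ω.length_trunc] at h1
  omega

/-- The points of `B` that never return to `B` form a measurable set disjoint from its non-trivial
translates, hence null. -/
theorem IsUniform.isRecurrentSet (hμ : IsUniform μ) (hT : IsGeodesicSpanningTree T)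
    {B : Set (Boundary A)} (hB : MeasurableSet B) (hlim : B ⊆ schreierLimitSet T) :
    IsRecurrentSet H μ B := by
  have := countable_freeGroup (A := A)
  let W : Set (Boundary A) := B ∩ ⋂ (h : H) (_ : h ≠ 1), ((h • ·) ⁻¹' B)ᶜ
  have hW : MeasurableSet W := hB.inter (MeasurableSet.iInter fun h =>
    MeasurableSet.iInter fun _ => (measurable_const_smul h hB).compl)
  have hmem : ∀ x, x ∈ W ↔ x ∈ B ∧ ∀ h : H, h ≠ 1 → h • x ∉ B := by
    intro x
    simp [W]
  have h0 : μ W = 0 := by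
    refine hμ.measure_eq_zero_of_wandering hT hW (Set.inter_subset_left.trans hlim) ?_
    intro x hx g hg hgx
    by_contra hne
    exact ((hmem x).1 hx).2 ⟨g, hg⟩ (fun h => hne (congrArg Subtype.val h)) ((hmem _).1 hgx).1
  rw [measure_eq_zero_iff_ae_notMem] at h0
  filter_upwards [h0] with x hx hxB
  by_contra! h
  exact hx ((hmem x).2 ⟨hxB, h⟩)

theorem IsUniform.isHopfDecomposition (hμ : IsUniform μ) (hT : IsGeodesicSpanningTree T) :
    IsHopfDecomposition H μ (schreierLimitSet T) (⋃ h : H, h • schreierDomain T) := by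
  have hS := hT.toIsSpanningTree
  have hD := measurableSet_iUnion_smul_schreierDomain T
  have hΩ := schreierLimitSet_eq_compl hS
  refine ⟨hΩ ▸ hD.compl, hD, ?_, ?_, fun g => ?_, fun g => ?_,
    fun B hB hBm _ => hμ.isRecurrentSet hT hBm hB,
    schreierDomain T, measurableSet_schreierDomain T, fun g h hgh =>
      (pairwise_disjoint_smul_schreierDomain hS hgh).aedisjoint, ae_eq_refl _⟩
  · rw [hΩ]
    exact disjoint_compl_left.aedisjoint
  · rw [hΩ, Set.compl_union_self]
    exact ae_eq_refl _
  · rw [hΩ, Set.smul_set_compl, smul_iUnion_smul]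
    exact ae_eq_refl _
  · rw [smul_iUnion_smul]
    exact ae_eq_refl _

/-- `C` meets Δ in a null set, because a point of Δ never returns to Δ; Ω meets a wandering set in a
null set, because almost every point of the intersection would have to return. Countability of `H`
and nonsingularity carry both facts to all translates. -/
theorem IsUniform.ae_eq_of_isHopfDecomposition (hμ : IsUniform μ) (hT : IsGeodesicSpanningTree T)
    {C D : Set (Boundary A)} (h : IsHopfDecomposition H μ C D) :
    C =ᵐ[μ] schreierLimitSet T ∧ D =ᵐ[μ] (⋃ h : H, h • schreierDomain T) := by
  have := countable_freeGroup (A := A)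
  have hS := hT.toIsSpanningTree
  have hΩD := schreierLimitSet_eq_compl hS
  have hH := hμ.isHopfDecomposition hT
  have hnull : ∀ (g : H) {E : Set (Boundary A)}, μ E = 0 → μ (g • E) = 0 :=
    fun g _ hE => hμ.measure_smul_null g hE
  have hC : μ (C ∩ ⋃ h : H, h • schreierDomain T) = 0 := by
    have h0 : μ (C ∩ schreierDomain T) = 0 := by
      by_contra hne
      have hrec := h.conservative (C ∩ schreierDomain T) Set.inter_subset_left
        (h.measurableSet_conservative.inter (measurableSet_schreierDomain T))
        (pos_iff_ne_zero.2 hne)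
      apply hne
      rw [measure_eq_zero_iff_ae_notMem]
      filter_upwards [hrec] with x hx hxB
      obtain ⟨g, hg, hgx⟩ := hx hxB
      exact hg (Subtype.ext (eq_one_of_smul_mem_schreierDomain hS g.2 hxB.2 hgx.2))
    rw [Set.inter_iUnion, measure_iUnion_null_iff]
    intro g
    have h1 : (g • (C ∩ schreierDomain T) : Set (Boundary A)) =ᵐ[μ]
        (C ∩ g • schreierDomain T : Set (Boundary A)) := by
      rw [Set.smul_set_inter]
      exact (h.smul_conservative g).inter (ae_eq_refl _)
    rw [← measure_congr h1]
    exact hnull g h0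
  have hD : μ (schreierLimitSet T ∩ D) = 0 := by
    obtain ⟨W, hW, hwand, hWD⟩ := h.dissipative
    have h0 : μ (schreierLimitSet T ∩ W) = 0 := by
      have hrec := hμ.isRecurrentSet hT (hH.measurableSet_conservative.inter hW)
        Set.inter_subset_left
      -- The translates of `W` are disjoint only mod 0, so the exceptional null sets are discarded
      -- for all of the countably many `g` at once.
      have hret : ∀ᵐ x ∂μ, ∀ g : H, g ≠ 1 → x ∉ W ∩ g⁻¹ • W := by
        refine ae_all_iff.2 fun g => ?_
        by_cases hg : g = 1
        · exact Eventually.of_forall fun x hx => (hx hg).elim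
        · have h1 : μ ((1 : H) • W ∩ g⁻¹ • W) = 0 := hwand (inv_ne_one.2 hg).symm
          rw [one_smul, measure_eq_zero_iff_ae_notMem] at h1
          filter_upwards [h1] with x hx _ using hx
      rw [measure_eq_zero_iff_ae_notMem]
      filter_upwards [hrec, hret] with x h1 h2 hx
      obtain ⟨g, hg, hgx⟩ := h1 hx
      exact h2 g hg ⟨hx.2, Set.mem_inv_smul_set_iff.2 hgx.2⟩
    have h1 : (schreierLimitSet T ∩ D : Set (Boundary A)) =ᵐ[μ]
        (schreierLimitSet T ∩ ⋃ g : H, g • W : Set (Boundary A)) :=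
      (ae_eq_refl _).inter hWD.symm
    rw [measure_congr h1, Set.inter_iUnion, measure_iUnion_null_iff]
    intro g
    have h2 : g • schreierLimitSet T = schreierLimitSet T := by
      rw [hΩD, Set.smul_set_compl, smul_iUnion_smul]
    rw [← h2, ← Set.smul_set_inter]
    exact hnull g h0
  rw [measure_eq_zero_iff_ae_notMem] at hC hD
  have hmem : ∀ x, x ∈ schreierLimitSet T ↔ x ∉ ⋃ h : H, h • schreierDomain T := by
    intro x
    rw [hΩD, Set.mem_compl_iff]
  have hun : ∀ᵐ x ∂μ, x ∈ C ∪ D := by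
    filter_upwards [h.union.mem_iff] with x hx using hx.2 trivial
  constructor
  · rw [eventuallyEq_set]
    filter_upwards [hC, hD, hun] with x h1 h2 h3
    have h4 := hmem x
    simp only [Set.mem_inter_iff, Set.mem_union] at h1 h2 h3
    tauto
  · rw [eventuallyEq_set]
    filter_upwards [hC, hD, hun] with x h1 h2 h3
    have h4 := hmem x
    simp only [Set.mem_inter_iff, Set.mem_union] at h1 h2 h3
    tauto

end HopfDecomposition

end FreeBoundary

theorem theorem2 {A : Type*} [Fintype A] [DecidableEq A] [Nontrivial A]
    (H : Subgroup (FreeGroup A)) (T : Set (FreeBoundary.Edge H))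
    (hT : FreeBoundary.IsGeodesicSpanningTree T) :
    -- the disjoint decomposition of the boundary determined by the tree
    (Pairwise fun h h' : H =>
      Disjoint (h • FreeBoundary.schreierDomain T) (h' • FreeBoundary.schreierDomain T)) ∧
    Disjoint (⋃ h : H, h • FreeBoundary.schreierDomain T) (FreeBoundary.schreierLimitSet T) ∧
    (⋃ h : H, h • FreeBoundary.schreierDomain T) ∪ FreeBoundary.schreierLimitSet T = Set.univ ∧
    -- it is a Hopf decomposition of the action of `H`
    FreeBoundary.IsHopfDecomposition H (FreeBoundary.uniformMeasure A)
      (FreeBoundary.schreierLimitSet T) (⋃ h : H, h • FreeBoundary.schreierDomain T) ∧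
    -- and every Hopf decomposition of this action coincides with it (mod 0)
    ∀ C D : Set (FreeBoundary.Boundary A),
      FreeBoundary.IsHopfDecomposition H (FreeBoundary.uniformMeasure A) C D →
      C =ᵐ[FreeBoundary.uniformMeasure A] FreeBoundary.schreierLimitSet T ∧
      D =ᵐ[FreeBoundary.uniformMeasure A] (⋃ h : H, h • FreeBoundary.schreierDomain T) := by
  have hS := hT.toIsSpanningTree
  have hΩ := FreeBoundary.schreierLimitSet_eq_compl hS
  have hμ := FreeBoundary.uniformMeasure_isUniform (A := A)
  refine ⟨FreeBoundary.pairwise_disjoint_smul_schreierDomain hS, ?_, ?_,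
    hμ.isHopfDecomposition hT, fun C D h => hμ.ae_eq_of_isHopfDecomposition hT h⟩
  · rw [hΩ]
    exact disjoint_compl_right
  · rw [hΩ, Set.union_compl_self]
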